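/- **Setting.** For each $n$ consider the random fully connected network of width $n$ and depth $T_n$ on $\{-1,1\}^n$: given weight matrices $\Theta=(\theta_1,\dots,\theta_{T_n})$, $\theta_t\in\mathbb{R}^{n\times n}$, and an input $\omega=\omega_0\in\{-1,1\}^n$, put $\omega_t=\mathrm{sign}(\theta_t\omega_{t-1})$ (pointwise) for $t=1,\dots,T_n$, and $f_{n,T_n}(\omega)=h_n(\omega_{T_n})$, where $h_n:\{-1,1\}^n\to\{-1,1\}$ is given. The $\theta_t$ are independent, and the columns of each $\theta_t$ are independent centred Gaussian vectors in $\mathbb{R}^n$ whose entries have variance $1$ and pairwise correlation $\rho=\rho_n$; that is, $\theta_t(i,j)=\sqrt{\rho_n}\,\nu_t(j)+\sqrt{1-\rho_n}\,\psi_t(i,j)$ with all $\nu_t(j),\psi_t(i,j)$ independent standard Gaussians. The function $h_n$ is odd if $h_n(-x)=-h_n(x)$ for all $x$. The sequence $\{h_n\}$ has a sharp threshold at $1/2$ if for all $p_n\in[0,1]$ with $\inf_n|p_n-1/2|>0$ one has $\mathrm{P}(h_n(X)=\mathrm{sign}(p_n-1/2))\to1$ as $n\to\infty$, where $X\in\{-1,1\}^n$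 has independent coordinates equal to $1$ with probability $p_n$ and to $-1$ with probability $1-p_n$. **Theorem.** There is a sequence $S_n$ of natural numbers such that the following holds. Suppose that for some $\delta>0$ independent of $n$, for all large $n$, $$\delta<\rho_n<1-\frac{4(\log\log n)^3}{\log n},\qquad T_n\ge e^{4(\log\log n)^2},$$ that $h_n$ is odd for all large $n$, and that either $\{h_n\}$ has a sharp threshold at $1/2$, or $T_n\ge S_n$ for all large $n$. Then: (i) For any $\omega^{(n)},\eta^{(n)}\in\{-1,1\}^n$ with $\eta^{(n)}\notin\{\omega^{(n)},-\omega^{(n)}\}$ for all large $n$, $$\lim_{n\to\infty}\mathrm{Cov}_\Theta\bigl(f_{n,T_n}(\omega^{(n)}),f_{n,T_n}(\eta^{(n)})\bigr)=0 .$$ (ii) For any probability measures $\mathbf{Q}_n$ on $\{-1,1\}^n\times\{-1,1\}^n$ with $\mathbf{Q}_n(\eta\in\{\omega,-\omega\})\to0$, if $(\omega,\eta)\sim\mathbf{Q}_n$ is independent of $\Theta$, then $$\lim_{n\to\infty}\mathrm{Cov}_{\mathbf{Q}_n,\Theta}\bigl(f_{n,T_n}(\omega),f_{n,T_n}(\eta)\bigr)=0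 .$$ (iii) Let $k_n\in\{1,\dots,n-1\}$ for all large $n$ (for instance $k_n=k$ constant), let $\omega^{(n)}\in\{-1,1\}^n$ and $\gamma>0$, and let $M_{k_n}$ be the number of $\eta\in\{-1,1\}^n$ that differ from $\omega^{(n)}$ in exactly $k_n$ coordinates and satisfy $f_{n,T_n}(\eta)\ne f_{n,T_n}(\omega^{(n)})$. Then $$\lim_{n\to\infty}\mathrm{P}\left(\frac{M_{k_n}}{\binom{n}{k_n}}\notin\left(\frac{1-\gamma}{2},\frac{1+\gamma}{2}\right)\right)=0 .$$ -/

import Mathlib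

open MeasureTheory ProbabilityTheory Filter Topology

noncomputable section

namespace BoolNet

/-- The Boolean cube `{-1, 1}^n`; the units of `ℤ` are exactly `1` and `-1`. -/
abbrev Cube (n : ℕ) : Type := Fin n → ℤˣ

/-- The sign of a real number, with values in `{-1, 1}`. The value at `0` is a convention:
the argument vanishes with probability zero wherever weights are drawn at random. -/
def sgn (x : ℝ) : ℤˣ := if 0 ≤ x then 1 else -1

/-- One layer of the network: `x ↦ sign (W x)`, the sign being taken pointwise. -/
def layer {n : ℕ} (W : Fin n → Fin n → ℝ) (x : Cube n) : Cube n :=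
  fun i => sgn (∑ j, W i j * (((x j : ℤˣ) : ℤ) : ℝ))

/-- The vector `ω_T` obtained from `ω_0 = x` by `ω_t = sign (θ_t ω_{t-1})`, `t = 1, …, T`;
the matrix `θ_t` is `θ (t - 1)` here. -/
def hiddenState {n : ℕ} : (T : ℕ) → (Fin T → Fin n → Fin n → ℝ) → Cube n → Cube n
  | 0, _, x => x
  | T + 1, θ, x => layer (θ (Fin.last T)) (hiddenState T (fun t => θ t.castSucc) x)

/-- The Boolean function `f(x) = h(ω_T)` computed by the network with weights `θ`. -/
def net {n T : ℕ} (h : Cube n → ℤˣ) (θ : Fin T → Fin n → Fin n → ℝ) (x : Cube n) : ℤˣ :=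
  h (hiddenState T θ x)

/-- The output of the network as a real number, `1` or `-1`. -/
def netReal {n T : ℕ} (h : Cube n → ℤˣ) (θ : Fin T → Fin n → Fin n → ℝ) (x : Cube n) : ℝ :=
  ((net h θ x : ℤ) : ℝ)

/-- The law of one weight matrix `W(i, j) = √ρ ν(j) + √(1 - ρ) ψ(i, j)`, where all `ν(j)` and
`ψ(i, j)` are independent standard Gaussians. For `0 ≤ ρ ≤ 1` the columns of `W` are independent
centred Gaussian vectors with unit variances and all correlations equal to `ρ`. -/
def layerLaw (n : ℕ) (ρ : ℝ) : Measure (Fin n → Fin n → ℝ) :=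
  ((Measure.pi fun _ : Fin n => gaussianReal 0 1).prod
    (Measure.pi fun _ : Fin n => Measure.pi fun _ : Fin n => gaussianReal 0 1)).map
    (fun p i j => √ρ * p.1 j + √(1 - ρ) * p.2 i j)

/-- The law of the weights `Θ = (θ_1, …, θ_T)`: independent matrices with law `layerLaw n ρ`. -/
def weightLaw (n T : ℕ) (ρ : ℝ) : Measure (Fin T → Fin n → Fin n → ℝ) :=
  Measure.pi fun _ : Fin T => layerLaw n ρ

/-- The law on the cube under which the coordinates are independent, equal to `1` with
probability `p` and to `-1` with probability `1 - p`. -/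
def biasedLaw (n : ℕ) (p : ℝ) : Measure (Cube n) :=
  Measure.pi fun _ : Fin n =>
    ENNReal.ofReal p • Measure.dirac (1 : ℤˣ) + ENNReal.ofReal (1 - p) • Measure.dirac (-1 : ℤˣ)

/-- The sequence `h` has a sharp threshold at `1/2`. -/
def HasSharpThreshold (h : ∀ n : ℕ, Cube n → ℤˣ) : Prop :=
  ∀ p : ℕ → ℝ, (∀ n, 0 ≤ p n ∧ p n ≤ 1) → (∃ γ > 0, ∀ n, γ ≤ |p n - 1 / 2|) →
    Tendsto (fun n => (biasedLaw n (p n)).real {x | h n x = sgn (p n - 1 / 2)}) atTop (𝓝 1)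

/-- The number `M_k(x)` of points `y` at Hamming distance exactly `k` from `x` at which the output
of the network differs from its output at `x`. -/
def flipCount {n T : ℕ} (h : Cube n → ℤˣ) (θ : Fin T → Fin n → Fin n → ℝ) (x : Cube n)
    (k : ℕ) : ℕ :=
  (Finset.univ.filter fun y : Cube n => hammingDist x y = k ∧ net h θ y ≠ net h θ x).card

end BoolNet

end

noncomputable section

namespace BoolNet

/-! Negating the last weight matrix shows that the outputs have mean zero, so everything reduces to
the correlation `pairCorr` of the outputs at two inputs. Two points `x`, `y` at distance `d` are
`(x+y)/2 ± (x-y)/2` with orthogonal summands, so a Gaussian row sees the pair only through `d`. The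
Hamming distance of the hidden states is therefore a Markov chain, with transition operator
`stepOp`. Driven by a common noise the chain is monotone in its starting point (`crossCount_mono`),
and it commutes with the reflection `d ↦ n - d` (`stepOp_reflect`). Let `g` be antitone, odd under
reflection and at most one. From a state at or beyond `n/2` the mean of `g` after any number of
steps is at most zero. Hence, from any state strictly between `0` and `n`, the mean of `g` is
bounded in modulus by the probability `surv` that the chain started at `1` has not reached `n/2`
(`abs_iterate_stepOp_le`).

This probability tends to zero (`tendsto_surv`). Put `l = log log n`. Given the common Gaussians the
rows are independent, and a row separates the inputs with probability at least of order `√(d/n)` as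
long as the first common Gaussian is not too large. So `d` grows to a multiple of `√(d n)`, which
essentially halves `log (n/d)`, and order `l` steps reach a distance proportional to `n`. One large
common Gaussian then carries the chain past `n/2`. Such a climb has probability at least `q exp(-(l²
+ 5l + 5))`, and `exp(2l²)` attempts suffice (`surv_mul_le`). Only a merging of the two states can
spoil the restarts. The upper bound on `ρ` makes it unlikely over the `exp(3l²)` steps needed
(`mergeProb_le_of_log`).

It remains to approximate the correlation by such a `g` (`abs_pairCorr_le_of_approx`). Under a sharp
threshold the output is nearly the sign of the common Gaussian of the last layer, and `g` is the
correlation of two such signs. For very deep networks the chain is absorbed at `0` or `n`, where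
oddness of `h` gives the product of outputs exactly. Statement (iii) then follows from a second
moment bound for the sum of the outputs over a Hamming sphere. -/

/-- The standard Gaussian measure on the plane. -/
abbrev gauss2 : Measure (ℝ × ℝ) := (gaussianReal 0 1).prod (gaussianReal 0 1)

/-- The law of the Gaussians that drive one step of the overlap chain. -/
abbrev noiseLaw (n : ℕ) : Measure ((ℝ × ℝ) × (Fin n → ℝ × ℝ)) :=
  gauss2.prod (Measure.pi fun _ => gauss2)

/-! ### Separation of two inputs by one row, and its monotonicity in the distance. -/

/-- The two preactivations `√(1-a) u ± √a v` have different signs. -/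
def Crossing (a u v : ℝ) : Prop :=
  sgn (√(1 - a) * u + √a * v) ≠ sgn (√(1 - a) * u - √a * v)

instance (a u v : ℝ) : Decidable (Crossing a u v) := inferInstanceAs (Decidable (_ ≠ _))

lemma sgn_of_nonneg {x : ℝ} (h : 0 ≤ x) : sgn x = 1 := if_pos h

lemma sgn_of_neg {x : ℝ} (h : x < 0) : sgn x = -1 := if_neg (not_le.2 h)

lemma sgn_neg {x : ℝ} (h : x ≠ 0) : sgn (-x) = -sgn x := by
  rcases lt_or_gt_of_ne h with h | h
  · rw [sgn_of_neg h, sgn_of_nonneg (by linarith)]; simp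
  · rw [sgn_of_nonneg h.le, sgn_of_neg (by linarith)]

lemma sgn_mul_pos {c : ℝ} (hc : 0 < c) (x : ℝ) : sgn (c * x) = sgn x := by
  unfold sgn; simp only [mul_nonneg_iff_of_pos_left hc]

@[fun_prop]
lemma measurable_sgn : Measurable sgn :=
  Measurable.ite measurableSet_Ici measurable_const measurable_const

instance : MeasurableSingletonClass ℤˣ :=
  ⟨fun u => ⟨{(u : ℤ)}, measurableSet_singleton _, by ext v; simp [Units.ext_iff]⟩⟩

lemma sgn_add_ne_sgn_sub_of_abs_lt {x y : ℝ} (h : |x| < |y|) : sgn (x + y) ≠ sgn (x - y) := by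
  obtain ⟨h1, h2⟩ := abs_lt.1 h
  rcases le_total 0 y with hy | hy
  · rw [abs_of_nonneg hy] at h1 h2
    rw [sgn_of_nonneg (by linarith), sgn_of_neg (by linarith)]; decide
  · rw [abs_of_nonpos hy] at h1 h2
    rw [sgn_of_neg (by linarith), sgn_of_nonneg (by linarith)]; decide

lemma abs_le_of_sgn_add_ne_sgn_sub {x y : ℝ} (h : sgn (x + y) ≠ sgn (x - y)) : |x| ≤ |y| := by
  by_contra! hc
  apply h
  rcases le_total 0 x with hx | hx
  · rw [abs_of_nonneg hx] at hc
    obtain ⟨h1, h2⟩ := abs_lt.1 hc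
    rw [sgn_of_nonneg (by linarith), sgn_of_nonneg (by linarith)]
  · rw [abs_of_nonpos hx] at hc
    obtain ⟨h1, h2⟩ := abs_lt.1 hc
    rw [sgn_of_neg (by linarith), sgn_of_neg (by linarith)]

/-- Up to boundary cases a crossing means `√(1-a)|u| ≤ √a|v|`, where the left side decreases and the
right side increases in `a`. The convention for the sign of `0` does no harm: a crossing forces `v ≠
0`, so the right side increases strictly. -/
lemma Crossing.mono {a b u v : ℝ} (ha : 0 ≤ a) (hab : a ≤ b) (h : Crossing a u v) :
    Crossing b u v := by
  rcases hab.eq_or_lt with rfl | hlt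
  · exact h
  have hv : v ≠ 0 := by
    rintro rfl
    exact h (by simp)
  apply sgn_add_ne_sgn_sub_of_abs_lt
  have h1 := abs_le_of_sgn_add_ne_sgn_sub h
  have h2 : √(1 - b) ≤ √(1 - a) := Real.sqrt_le_sqrt (by linarith)
  have h3 : √a < √b := Real.sqrt_lt_sqrt ha hlt
  rw [abs_mul, abs_mul, abs_of_nonneg (Real.sqrt_nonneg _), abs_of_nonneg (Real.sqrt_nonneg _)]
    at h1 ⊢
  calc √(1 - b) * |u| ≤ √(1 - a) * |u| := by gcongr
    _ ≤ √a * |v| := h1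
    _ < √b * |v| := by have := abs_pos.2 hv; gcongr

/-- The number of rows in which two inputs at Hamming distance `d` are sent to different signs,
as a function of the driving noise. -/
def crossCount (n : ℕ) (ρ : ℝ) (d : ℕ) (ξ : (ℝ × ℝ) × (Fin n → ℝ × ℝ)) : ℕ :=
  (Finset.univ.filter fun i => Crossing ((d : ℝ) / n) (√ρ * ξ.1.1 + √(1 - ρ) * (ξ.2 i).1)
    (√ρ * ξ.1.2 + √(1 - ρ) * (ξ.2 i).2)).card

lemma crossCount_le (n : ℕ) (ρ : ℝ) (d : ℕ) (ξ) : crossCount n ρ d ξ ≤ n :=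
  (Finset.card_le_univ _).trans (by simp)

/-- This is the monotone coupling: one noise drives the chain from all starting points at once, and
each row that separates at a smaller distance still separates at a larger one. -/
lemma crossCount_mono (n : ℕ) (ρ : ℝ) (ξ) : Monotone fun d => crossCount n ρ d ξ := by
  intro d e hde
  refine Finset.card_le_card fun i => ?_
  simp only [Finset.mem_filter, Finset.mem_univ, true_and]
  exact Crossing.mono (by positivity) (by gcongr)

@[fun_prop]
lemma measurable_crossCount (n : ℕ) (ρ : ℝ) (d : ℕ) : Measurable (crossCount n ρ d) := by
  have : crossCount n ρ d = fun ξ => ∑ i, if Crossing ((d : ℝ) / n)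
      (√ρ * ξ.1.1 + √(1 - ρ) * (ξ.2 i).1) (√ρ * ξ.1.2 + √(1 - ρ) * (ξ.2 i).2) then 1 else 0 := by
    ext ξ
    rw [crossCount, Finset.card_filter]
  rw [this]
  refine Finset.measurable_sum _ fun i _ => Measurable.ite ?_ measurable_const measurable_const
  exact (measurableSet_eq_fun (f := fun ξ : (ℝ × ℝ) × (Fin n → ℝ × ℝ) => sgn _) (by fun_prop)
    (by fun_prop)).compl

/-! ### The transition operator and its order properties. -/

/-- The transition operator of the overlap chain. -/
def stepOp (n : ℕ) (ρ : ℝ) (g : ℕ → ℝ) (d : ℕ) : ℝ := ∫ ξ, g (crossCount n ρ d ξ) ∂noiseLaw n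

lemma integrable_of_nat_le {α : Type*} [MeasurableSpace α] {μ : Measure α} [IsFiniteMeasure μ]
    {c : α → ℕ} (hc : Measurable c) {n : ℕ} (hn : ∀ x, c x ≤ n) (g : ℕ → ℝ) :
    Integrable (fun x => g (c x)) μ := by
  refine Integrable.of_bound ((measurable_of_countable g).comp hc).aestronglyMeasurable
    (∑ i ∈ Finset.range (n + 1), |g i|) (ae_of_all _ fun x => ?_)
  exact Finset.single_le_sum (f := fun i => |g i|) (fun _ _ => abs_nonneg _)
    (Finset.mem_range.2 (Nat.lt_succ_of_le (hn x)))

lemma integrable_crossCount (n : ℕ) (ρ : ℝ) (d : ℕ) (g : ℕ → ℝ) :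
    Integrable (fun ξ => g (crossCount n ρ d ξ)) (noiseLaw n) :=
  integrable_of_nat_le (measurable_crossCount n ρ d) (crossCount_le n ρ d) g

variable {n : ℕ} {ρ : ℝ}

lemma stepOp_le {g g' : ℕ → ℝ} (h : ∀ d ≤ n, g d ≤ g' d) (d : ℕ) :
    stepOp n ρ g d ≤ stepOp n ρ g' d :=
  integral_mono (integrable_crossCount ..) (integrable_crossCount ..) fun ξ =>
    h _ (crossCount_le n ρ d ξ)

lemma stepOp_congr {g g' : ℕ → ℝ} (h : ∀ d ≤ n, g d = g' d) (d : ℕ) :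
    stepOp n ρ g d = stepOp n ρ g' d :=
  integral_congr_ae (ae_of_all _ fun ξ => h _ (crossCount_le n ρ d ξ))

lemma stepOp_add (g g' : ℕ → ℝ) (d : ℕ) :
    stepOp n ρ (fun e => g e + g' e) d = stepOp n ρ g d + stepOp n ρ g' d :=
  integral_add (integrable_crossCount ..) (integrable_crossCount ..)

lemma stepOp_const_mul (c : ℝ) (g : ℕ → ℝ) (d : ℕ) :
    stepOp n ρ (fun e => c * g e) d = c * stepOp n ρ g d :=
  integral_const_mul _ _

lemma stepOp_neg (g : ℕ → ℝ) (d : ℕ) :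
    stepOp n ρ (fun e => -g e) d = -stepOp n ρ g d :=
  integral_neg _

lemma stepOp_const (c : ℝ) (d : ℕ) : stepOp n ρ (fun _ => c) d = c := by
  simp [stepOp]

lemma stepOp_antitone {g : ℕ → ℝ} (hg : Antitone g) : Antitone (stepOp n ρ g) := fun _ _ hde =>
  integral_mono (integrable_crossCount ..) (integrable_crossCount ..) fun ξ =>
    hg (crossCount_mono n ρ ξ hde)

lemma stepOp_nonneg {g : ℕ → ℝ} (hg : ∀ d, 0 ≤ g d) (d : ℕ) : 0 ≤ stepOp n ρ g d :=
  integral_nonneg fun _ => hg _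

lemma stepOp_indicator (p : ℕ → Prop) [DecidablePred p] (d : ℕ) :
    stepOp n ρ (fun e => if p e then 1 else 0) d
      = (noiseLaw n).real {ξ | p (crossCount n ρ d ξ)} := by
  have hm : MeasurableSet {ξ | p (crossCount n ρ d ξ)} :=
    measurable_crossCount n ρ d (MeasurableSet.of_discrete (s := {e | p e}))
  rw [← integral_indicator_one hm]
  exact integral_congr_ae (ae_of_all _ fun ξ => by simp [Set.indicator_apply])

/-! ### The law of the Hamming distance after one random layer. -/

lemma charFunDual_gaussianReal_zero_one (L : StrongDual ℝ ℝ) :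
    charFunDual (gaussianReal 0 1) L = Complex.exp (((-(L 1) ^ 2 / 2 : ℝ) : ℂ)) := by
  rw [charFunDual_eq_charFun_map_one, gaussianReal_map_continuousLinearMap, charFun_gaussianReal]
  congr 1
  have : (0 : ℝ) ≤ L 1 ^ 2 := sq_nonneg _
  simp [this]
  ring

/-- Two orthogonal linear functionals of a standard Gaussian vector are independent centred
Gaussians. -/
lemma map_pi_gaussianReal_orthogonal (a b : Fin n → ℝ) (hab : ∑ j, a j * b j = 0) :
    (Measure.pi fun _ : Fin n => gaussianReal 0 1).map
        (fun v => (∑ j, v j * a j, ∑ j, v j * b j))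
      = gauss2.map (fun z => (√(∑ j, a j ^ 2) * z.1, √(∑ j, b j ^ 2) * z.2)) := by
  let A : (Fin n → ℝ) →L[ℝ] ℝ × ℝ :=
    (∑ j, a j • ContinuousLinearMap.proj (R := ℝ) (φ := fun _ : Fin n => ℝ) j).prod
      (∑ j, b j • ContinuousLinearMap.proj (R := ℝ) (φ := fun _ : Fin n => ℝ) j)
  let B : ℝ × ℝ →L[ℝ] ℝ × ℝ :=
    (√(∑ j, a j ^ 2) • ContinuousLinearMap.fst ℝ ℝ ℝ).prod
      (√(∑ j, b j ^ 2) • ContinuousLinearMap.snd ℝ ℝ ℝ)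
  have hA : (fun v : Fin n → ℝ => (∑ j, v j * a j, ∑ j, v j * b j)) = A := by
    ext v <;> simp [A, mul_comm]
  have hB : (fun z : ℝ × ℝ => (√(∑ j, a j ^ 2) * z.1, √(∑ j, b j ^ 2) * z.2)) = B := by
    ext v <;> simp [B]
  rw [hA, hB]
  have : IsProbabilityMeasure ((Measure.pi fun _ : Fin n => gaussianReal 0 1).map A) :=
    Measure.isProbabilityMeasure_map A.continuous.measurable.aemeasurable
  have : IsProbabilityMeasure (gauss2.map B) :=
    Measure.isProbabilityMeasure_map B.continuous.measurable.aemeasurable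
  refine Measure.ext_of_charFunDual ?_
  ext L
  rw [charFunDual_map, charFunDual_map, charFunDual_pi, charFunDual_prod]
  simp only [charFunDual_gaussianReal_zero_one]
  rw [← Complex.exp_sum, ← Complex.exp_add]
  congr 1
  norm_cast
  have hL : ∀ p q : ℝ, L (p, q) = p * L (1, 0) + q * L (0, 1) := fun p q => by
    have : ((p, q) : ℝ × ℝ) = p • (1, 0) + q • (0, 1) := by simp
    rw [this, map_add, map_smul, map_smul]; rfl
  have h1 : ∀ j, (L.comp A).comp (ContinuousLinearMap.single ℝ (fun _ : Fin n => ℝ) j) 1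
      = a j * L (1, 0) + b j * L (0, 1) := fun j => by
    have : A (Pi.single j 1) = (a j, b j) := by
      rw [← hA]; simp [Pi.single_apply]
    simp [this, hL (a j) (b j)]
  have h2 : (L.comp B).comp (ContinuousLinearMap.inl ℝ ℝ ℝ) 1 = √(∑ j, a j ^ 2) * L (1, 0) := by
    have : B (1, 0) = (√(∑ j, a j ^ 2), 0) := by rw [← hB]; simp
    simp [this, hL (√(∑ j, a j ^ 2)) 0]
  have h3 : (L.comp B).comp (ContinuousLinearMap.inr ℝ ℝ ℝ) 1 = √(∑ j, b j ^ 2) * L (0, 1) := by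
    have : B (0, 1) = (0, √(∑ j, b j ^ 2)) := by rw [← hB]; simp
    simp [this, hL 0 (√(∑ j, b j ^ 2))]
  rw [h2, h3]
  simp only [h1]
  rw [mul_pow, mul_pow, Real.sq_sqrt (Finset.sum_nonneg fun _ _ => sq_nonneg _),
    Real.sq_sqrt (Finset.sum_nonneg fun _ _ => sq_nonneg _)]
  -- The cross term is all that distinguishes the two characteristic functions; `hab` removes it.
  have h4 : ∑ j, (a j * L (1, 0) + b j * L (0, 1)) ^ 2
      = (∑ j, a j ^ 2) * L (1, 0) ^ 2 + (∑ j, b j ^ 2) * L (0, 1) ^ 2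
        + 2 * L (1, 0) * L (0, 1) * ∑ j, a j * b j := by
    rw [Finset.sum_mul, Finset.sum_mul, Finset.mul_sum, ← Finset.sum_add_distrib,
      ← Finset.sum_add_distrib]
    exact Finset.sum_congr rfl fun j _ => by ring
  rw [hab] at h4
  rw [← Finset.sum_div, Finset.sum_neg_distrib, h4]
  ring

/-- The real inner product of a weight vector with a point of the cube. -/
def dot (v : Fin n → ℝ) (x : Cube n) : ℝ := ∑ j, v j * ((x j : ℤ) : ℝ)

lemma layer_apply (W : Fin n → Fin n → ℝ) (x : Cube n) (i : Fin n) :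
    layer W x i = sgn (dot (W i) x) := rfl

@[fun_prop]
lemma measurable_dot (x : Cube n) : Measurable fun v : Fin n → ℝ => dot v x := by
  unfold dot; fun_prop

lemma dot_neg (v : Fin n → ℝ) (x : Cube n) : dot v (-x) = -dot v x := by
  simp [dot]

lemma neg_dot (v : Fin n → ℝ) (x : Cube n) : dot (-v) x = -dot v x := by
  simp [dot]

lemma dot_comb (s t : ℝ) (v w : Fin n → ℝ) (x : Cube n) :
    dot (fun j => s * v j + t * w j) x = s * dot v x + t * dot w x := by
  simp only [dot, Finset.mul_sum, ← Finset.sum_add_distrib]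
  exact Finset.sum_congr rfl fun j _ => by ring

lemma hammingDist_le_card (x y : Cube n) : hammingDist x y ≤ n := by
  simpa using hammingDist_le_card_fintype (x := x) (y := y)

lemma units_cast_sq (u : ℤˣ) : ((u : ℤ) : ℝ) ^ 2 = 1 := by
  rcases Int.units_eq_one_or u with rfl | rfl <;> simp

lemma sum_sub_sq (x y : Cube n) :
    ∑ j, ((((x j : ℤ) : ℝ) - ((y j : ℤ) : ℝ)) / 2) ^ 2 = (hammingDist x y : ℝ) := by
  rw [hammingDist, Finset.card_filter, Nat.cast_sum]
  refine Finset.sum_congr rfl fun j _ => ?_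
  rcases Int.units_eq_one_or (x j) with h | h <;> rcases Int.units_eq_one_or (y j) with h' | h' <;>
    norm_num [h, h']

lemma sum_add_sq (x y : Cube n) :
    ∑ j, ((((x j : ℤ) : ℝ) + ((y j : ℤ) : ℝ)) / 2) ^ 2 = (n : ℝ) - (hammingDist x y : ℝ) := by
  rw [← sum_sub_sq, eq_sub_iff_add_eq, ← Finset.sum_add_distrib]
  calc _ = ∑ j : Fin n, (1 : ℝ) := Finset.sum_congr rfl fun j _ => by
        have h1 := units_cast_sq (x j)
        have h2 := units_cast_sq (y j)
        linear_combination h1 / 2 + h2 / 2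
    _ = n := by simp

lemma hammingDist_neg_right (x y : Cube n) : hammingDist x (-y) = n - hammingDist x y := by
  have h1 := sum_sub_sq x (-y)
  have h2 := sum_add_sq x y
  have : (hammingDist x (-y) : ℝ) = n - hammingDist x y := by
    rw [← h1, ← h2]
    refine Finset.sum_congr rfl fun j _ => ?_
    simp
  rw [← Nat.cast_sub (hammingDist_le_card x y)] at this
  exact_mod_cast this

/-- The law of the inner products of a Gaussian vector with two points of the cube. -/
lemma map_dot_pair (x y : Cube n) :
    (Measure.pi fun _ : Fin n => gaussianReal 0 1).map (fun v => (dot v x, dot v y))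
      = gauss2.map (fun z =>
        (√(n - (hammingDist x y : ℝ)) * z.1 + √(hammingDist x y : ℝ) * z.2,
          √(n - (hammingDist x y : ℝ)) * z.1 - √(hammingDist x y : ℝ) * z.2)) := by
  -- Half sum and half difference are orthogonal because `x j ^ 2 = y j ^ 2`; their squared norms
  -- are `n - d` and `d`. Sum and difference of the two functionals recover the inner products with
  -- `x` and `y`.
  have h := map_pi_gaussianReal_orthogonal
    (fun j => (((x j : ℤ) : ℝ) + ((y j : ℤ) : ℝ)) / 2)
    (fun j => (((x j : ℤ) : ℝ) - ((y j : ℤ) : ℝ)) / 2)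
    (Finset.sum_eq_zero fun j _ => by
      linear_combination units_cast_sq (x j) / 4 - units_cast_sq (y j) / 4)
  rw [sum_add_sq, sum_sub_sq] at h
  have h' := congrArg (Measure.map fun p : ℝ × ℝ => (p.1 + p.2, p.1 - p.2)) h
  rw [Measure.map_map (by fun_prop) (by fun_prop), Measure.map_map (by fun_prop) (by fun_prop)]
    at h'
  convert! h' using 1
  congr 1
  ext v <;> simp only [dot, Function.comp, ← Finset.sum_add_distrib, ← Finset.sum_sub_distrib] <;>
    exact Finset.sum_congr rfl fun j _ => by ring

/-- The law of the standard Gaussians `ν`, `ψ` from which a weight matrix is built. -/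
abbrev baseLaw (n : ℕ) : Measure ((Fin n → ℝ) × (Fin n → Fin n → ℝ)) :=
  (Measure.pi fun _ : Fin n => gaussianReal 0 1).prod
    (Measure.pi fun _ : Fin n => Measure.pi fun _ : Fin n => gaussianReal 0 1)

/-- The weight matrix built from the Gaussians `ν`, `ψ`. -/
def combine (ρ : ℝ) (p : (Fin n → ℝ) × (Fin n → Fin n → ℝ)) : Fin n → Fin n → ℝ :=
  fun i j => √ρ * p.1 j + √(1 - ρ) * p.2 i j

@[fun_prop]
lemma measurable_combine : Measurable (combine (n := n) ρ) := by
  unfold combine; fun_prop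

lemma layerLaw_eq : layerLaw n ρ = (baseLaw n).map (combine ρ) := rfl

instance : IsProbabilityMeasure (layerLaw n ρ) :=
  Measure.isProbabilityMeasure_map measurable_combine.aemeasurable

lemma dot_combine (p : (Fin n → ℝ) × (Fin n → Fin n → ℝ)) (i : Fin n) (x : Cube n) :
    dot (combine ρ p i) x = √ρ * dot p.1 x + √(1 - ρ) * dot (p.2 i) x :=
  dot_comb ..

/-- The inner products of two inputs at distance `d` with a Gaussian vector, in terms of two
independent standard Gaussians. -/
def spread (n d : ℕ) (z : ℝ × ℝ) : ℝ × ℝ :=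
  (√(n - d) * z.1 + √d * z.2, √(n - d) * z.1 - √d * z.2)

@[fun_prop]
lemma measurable_spread (d : ℕ) : Measurable (spread n d) := by
  unfold spread; fun_prop

lemma map_baseLaw_dot_pair (x y : Cube n) :
    (baseLaw n).map (Prod.map (fun v => (dot v x, dot v y)) fun ψ i => (dot (ψ i) x, dot (ψ i) y))
      = (noiseLaw n).map (Prod.map (spread n (hammingDist x y))
          fun w i => spread n (hammingDist x y) (w i)) := by
  have hP : Measurable fun v : Fin n → ℝ => (dot v x, dot v y) := by fun_prop
  have : IsProbabilityMeasure
      ((Measure.pi fun _ : Fin n => gaussianReal 0 1).map fun v => (dot v x, dot v y)) :=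
    Measure.isProbabilityMeasure_map hP.aemeasurable
  have : IsProbabilityMeasure (gauss2.map (spread n (hammingDist x y))) :=
    Measure.isProbabilityMeasure_map (measurable_spread _).aemeasurable
  rw [← Measure.map_prod_map _ _ hP (by fun_prop), ← Measure.map_prod_map _ _ (by fun_prop)
    (by fun_prop), Measure.pi_map_pi (fun _ => hP.aemeasurable),
    Measure.pi_map_pi (fun _ => (measurable_spread _).aemeasurable), map_dot_pair]
  rfl

lemma sgn_spread_ne_iff {d : ℕ} (hn : 0 < n) (z w : ℝ × ℝ) :
    (sgn (√ρ * (spread n d z).1 + √(1 - ρ) * (spread n d w).1)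
      ≠ sgn (√ρ * (spread n d z).2 + √(1 - ρ) * (spread n d w).2)) ↔
    Crossing ((d : ℝ) / n) (√ρ * z.1 + √(1 - ρ) * w.1) (√ρ * z.2 + √(1 - ρ) * w.2) := by
  have hn' : (0 : ℝ) < n := by exact_mod_cast hn
  have h1 : √((n : ℝ) - d) = √n * √(1 - d / n) := by
    rw [← Real.sqrt_mul hn'.le]; congr 1; field_simp
  have h2 : √(d : ℝ) = √n * √(d / n) := by
    rw [← Real.sqrt_mul hn'.le]; congr 1; field_simp
  have h3 := Real.sqrt_pos.2 hn'
  unfold Crossing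
  have h4 : √ρ * (spread n d z).1 + √(1 - ρ) * (spread n d w).1
      = √n * (√(1 - d / n) * (√ρ * z.1 + √(1 - ρ) * w.1)
        + √(d / n) * (√ρ * z.2 + √(1 - ρ) * w.2)) := by
    simp only [spread, h1, h2]; ring
  have h5 : √ρ * (spread n d z).2 + √(1 - ρ) * (spread n d w).2
      = √n * (√(1 - d / n) * (√ρ * z.1 + √(1 - ρ) * w.1)
        - √(d / n) * (√ρ * z.2 + √(1 - ρ) * w.2)) := by
    simp only [spread, h1, h2]; ring
  rw [h4, h5, sgn_mul_pos h3, sgn_mul_pos h3]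

lemma hammingDist_layer (W : Fin n → Fin n → ℝ) (x y : Cube n) :
    hammingDist (layer W x) (layer W y)
      = (Finset.univ.filter fun i => sgn (dot (W i) x) ≠ sgn (dot (W i) y)).card := rfl

/-- The Hamming distance of the images of two inputs under a random layer. -/
lemma integral_hammingDist_layer (hn : 0 < n) (g : ℕ → ℝ) (x y : Cube n) :
    ∫ W, g (hammingDist (layer W x) (layer W y)) ∂layerLaw n ρ
      = stepOp n ρ g (hammingDist x y) := by
  let H : (ℝ × ℝ) × (Fin n → ℝ × ℝ) → ℕ := fun ξ =>
    (Finset.univ.filter fun i => sgn (√ρ * ξ.1.1 + √(1 - ρ) * (ξ.2 i).1) ≠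
      sgn (√ρ * ξ.1.2 + √(1 - ρ) * (ξ.2 i).2)).card
  have hH : Measurable H := by
    have : H = fun ξ => ∑ i, if sgn (√ρ * ξ.1.1 + √(1 - ρ) * (ξ.2 i).1) ≠
      sgn (√ρ * ξ.1.2 + √(1 - ρ) * (ξ.2 i).2) then 1 else 0 := by
      ext ξ
      simp only [H, Finset.card_filter]
    rw [this]
    refine Finset.measurable_sum _ fun i _ => Measurable.ite ?_ measurable_const measurable_const
    exact (measurableSet_eq_fun (by fun_prop) (by fun_prop)).compl
  have hgH : Measurable fun ξ => g (H ξ) := (measurable_of_countable g).comp hH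
  have hF : Measurable fun W : Fin n → Fin n → ℝ => g (hammingDist (layer W x) (layer W y)) := by
    refine (measurable_of_countable g).comp ?_
    simp only [hammingDist_layer, Finset.card_filter]
    refine Finset.measurable_sum _ fun i _ => Measurable.ite ?_ measurable_const measurable_const
    exact (measurableSet_eq_fun (by fun_prop) (by fun_prop)).compl
  rw [layerLaw_eq, integral_map measurable_combine.aemeasurable hF.aestronglyMeasurable]
  have h1 : ∀ p : (Fin n → ℝ) × (Fin n → Fin n → ℝ),
      g (hammingDist (layer (combine ρ p) x) (layer (combine ρ p) y)) =
      g (H (Prod.map (fun v => (dot v x, dot v y)) (fun ψ i => (dot (ψ i) x, dot (ψ i) y)) p)) := by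
    intro p
    simp only [H, hammingDist_layer, dot_combine, Prod.map_fst, Prod.map_snd]
  simp only [h1]
  rw [← integral_map (μ := baseLaw n) (f := fun ξ => g (H ξ)) (by fun_prop)
    hgH.aestronglyMeasurable, map_baseLaw_dot_pair,
    integral_map (by fun_prop) hgH.aestronglyMeasurable]
  simp only [stepOp]
  refine integral_congr_ae (ae_of_all _ fun ξ => ?_)
  simp only [H, crossCount, Prod.map_fst, Prod.map_snd]
  congr 2
  ext i
  simp only [Finset.mem_filter, Finset.mem_univ, true_and]
  exact sgn_spread_ne_iff hn _ _

/-! ### Nondegeneracy and the reflection symmetry of the chain. -/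

lemma map_dot (x : Cube n) :
    (Measure.pi fun _ : Fin n => gaussianReal 0 1).map (fun v => dot v x)
      = (gaussianReal 0 1).map (fun z => √n * z) := by
  have h := congrArg (Measure.map Prod.fst) (map_dot_pair x x)
  rw [Measure.map_map measurable_fst (by fun_prop), Measure.map_map measurable_fst (by fun_prop)]
    at h
  have h2 : (Prod.fst ∘ fun z : ℝ × ℝ =>
        (√(n - (hammingDist x x : ℝ)) * z.1 + √(hammingDist x x : ℝ) * z.2,
          √(n - (hammingDist x x : ℝ)) * z.1 - √(hammingDist x x : ℝ) * z.2))
      = (fun z => √n * z) ∘ Prod.fst := by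
    ext z; simp
  rw [h2, ← Measure.map_map (by fun_prop) measurable_fst, measurePreserving_fst.map_eq] at h
  exact h

lemma nullSingletonClass_gauss : NullSingletonClass (gaussianReal 0 1) :=
  nullSingletonClass_gaussianReal one_ne_zero

lemma ae_dot_ne (hn : 0 < n) (x : Cube n) (c : ℝ) :
    ∀ᵐ v ∂(Measure.pi fun _ : Fin n => gaussianReal 0 1), dot v x ≠ c := by
  have := nullSingletonClass_gauss
  have h : ∀ᵐ u ∂((Measure.pi fun _ : Fin n => gaussianReal 0 1).map (fun v => dot v x)),
      u ≠ c := by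
    have hn' : √(n : ℝ) ≠ 0 := by positivity
    have hm : MeasurableSet {u : ℝ | u ≠ c} := (measurableSet_singleton c).compl
    rw [map_dot, ae_map_iff (by fun_prop) hm]
    filter_upwards [(Set.countable_singleton (c / √n)).ae_notMem (gaussianReal 0 1)] with z hz h
    apply hz
    simp only [Set.mem_singleton_iff]
    rw [← h]; field_simp
  exact ae_of_ae_map (measurable_dot x).aemeasurable h

/-- For fixed common part the row part still has a continuous law, since `ρ < 1`. This makes the
sign convention at `0` immaterial and a layer almost surely odd. -/
lemma ae_dot_row_ne_zero (hρ : ρ < 1) (x : Cube n) :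
    ∀ᵐ W ∂layerLaw n ρ, ∀ i, dot (W i) x ≠ 0 := by
  have hs : √(1 - ρ) ≠ 0 := (Real.sqrt_pos.2 (by linarith)).ne'
  rw [ae_all_iff]
  intro i
  have hm : MeasurableSet {W : Fin n → Fin n → ℝ | dot (W i) x ≠ 0} :=
    (measurableSet_eq_fun (by fun_prop) (by fun_prop)).compl
  rw [layerLaw_eq, ae_map_iff measurable_combine.aemeasurable hm]
  rw [Measure.ae_prod_iff_ae_ae
    (p := fun p : (Fin n → ℝ) × (Fin n → Fin n → ℝ) => dot (combine ρ p i) x ≠ 0)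
    (measurable_combine hm)]
  refine ae_of_all _ fun ν => ?_
  have h := ae_dot_ne (n := n) i.pos x (-(√ρ * dot ν x) / √(1 - ρ))
  have h' := (measurePreserving_eval (fun _ : Fin n => Measure.pi fun _ : Fin n =>
    gaussianReal 0 1) i).quasiMeasurePreserving.ae h
  filter_upwards [h'] with ψ hψ h0
  apply hψ
  rw [dot_combine] at h0
  rw [eq_div_iff hs]
  simp only [Function.eval]
  linarith

lemma layer_neg_of_ne {W : Fin n → Fin n → ℝ} {x : Cube n} (h : ∀ i, dot (W i) x ≠ 0) :
    layer W (-x) = -layer W x := by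
  ext1 i
  rw [layer_apply, dot_neg, sgn_neg (h i)]; rfl

lemma neg_layer_of_ne {W : Fin n → Fin n → ℝ} {x : Cube n} (h : ∀ i, dot (W i) x ≠ 0) :
    layer (-W) x = -layer W x := by
  ext1 i
  rw [layer_apply, Pi.neg_apply, neg_dot, sgn_neg (h i)]; rfl

lemma exists_hammingDist_eq {d : ℕ} (hd : d ≤ n) : ∃ x y : Cube n, hammingDist x y = d := by
  refine ⟨fun _ => 1, fun j => if (j : ℕ) < d then -1 else 1, ?_⟩
  have : (Finset.univ.filter fun j : Fin n => (1 : ℤˣ) ≠ if (j : ℕ) < d then -1 else 1)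
      = Finset.univ.filter fun j : Fin n => (j : ℕ) < d := by
    ext j
    by_cases h : (j : ℕ) < d <;> simp [h]
  rw [hammingDist, this, Fin.card_filter_val_lt]
  simp [hd]

/-- Replacing `y` by `-y` turns distance `d` into `n - d`, and a layer almost surely commutes with
this replacement. -/
lemma stepOp_reflect (hρ : ρ < 1) (hn : 0 < n) (g : ℕ → ℝ) {d : ℕ} (hd : d ≤ n) :
    stepOp n ρ (fun e => g (n - e)) d = stepOp n ρ g (n - d) := by
  obtain ⟨x, y, rfl⟩ := exists_hammingDist_eq hd
  rw [← hammingDist_neg_right, ← integral_hammingDist_layer hn, ← integral_hammingDist_layer hn]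
  refine integral_congr_ae ?_
  filter_upwards [ae_dot_row_ne_zero hρ y] with W hW
  rw [layer_neg_of_ne hW, hammingDist_neg_right]

/-! ### Survival below `n / 2` and odd antitone functions. -/

/-- The indicator of the distances below `n / 2`. -/
def below (n d : ℕ) : ℝ := if 2 * d < n then 1 else 0

lemma below_antitone (n : ℕ) : Antitone (below n) := by
  intro d e hde
  unfold below
  split_ifs
  · exact le_rfl
  · omega
  · exact zero_le_one
  · exact le_rfl

lemma below_nonneg (n d : ℕ) : 0 ≤ below n d := by unfold below; split_ifs <;> simp

lemma below_le_one (n d : ℕ) : below n d ≤ 1 := by unfold below; split_ifs <;> simp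

/-- The probability that the overlap chain started at distance `d` stays below `n / 2` up to
time `t`. -/
def surv (n : ℕ) (ρ : ℝ) : ℕ → ℕ → ℝ
  | 0, d => below n d
  | t + 1, d => below n d * stepOp n ρ (surv n ρ t) d

lemma surv_nonneg (t d : ℕ) : 0 ≤ surv n ρ t d := by
  induction t generalizing d with
  | zero => exact below_nonneg n d
  | succ t ih => exact mul_nonneg (below_nonneg n d) (stepOp_nonneg ih d)

lemma surv_antitone (t : ℕ) : Antitone (surv n ρ t) := by
  induction t with
  | zero => exact below_antitone n
  | succ t ih =>
    exact fun d e hde => mul_le_mul (below_antitone n hde) (stepOp_antitone ih hde)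
      (stepOp_nonneg (surv_nonneg t) e) (below_nonneg n d)

lemma surv_le_below (t d : ℕ) : surv n ρ t d ≤ below n d := by
  induction t generalizing d with
  | zero => exact le_rfl
  | succ t ih =>
    have : stepOp n ρ (surv n ρ t) d ≤ 1 := by
      rw [← stepOp_const (n := n) (ρ := ρ) 1 d]
      exact stepOp_le (fun e _ => (ih e).trans (below_le_one n e)) d
    exact mul_le_of_le_one_right (below_nonneg n d) this

lemma surv_le_one (t d : ℕ) : surv n ρ t d ≤ 1 := (surv_le_below t d).trans (below_le_one n d)

lemma surv_succ_le_stepOp (t d : ℕ) : surv n ρ (t + 1) d ≤ stepOp n ρ (surv n ρ t) d :=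
  mul_le_of_le_one_left (stepOp_nonneg (surv_nonneg t) d) (below_le_one n d)

lemma surv_succ_le (t d : ℕ) : surv n ρ (t + 1) d ≤ surv n ρ t d := by
  induction t generalizing d with
  | zero => exact surv_le_below 1 d
  | succ t ih => exact mul_le_mul_of_nonneg_left (stepOp_le (fun e _ => ih e) d) (below_nonneg n d)

lemma surv_antitone_time (d : ℕ) : Antitone fun t => surv n ρ t d :=
  antitone_nat_of_succ_le fun t => surv_succ_le t d

lemma iterate_stepOp_antitone {g : ℕ → ℝ} (hg : Antitone g) (t : ℕ) :
    Antitone ((stepOp n ρ)^[t] g) := by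
  induction t with
  | zero => exact hg
  | succ t ih => rw [Function.iterate_succ_apply']; exact stepOp_antitone ih

lemma iterate_stepOp_odd (hρ : ρ < 1) (hn : 0 < n) {g : ℕ → ℝ}
    (hg : ∀ d ≤ n, g (n - d) = -g d) (t : ℕ) :
    ∀ d ≤ n, (stepOp n ρ)^[t] g (n - d) = -(stepOp n ρ)^[t] g d := by
  induction t with
  | zero => exact hg
  | succ t ih =>
    intro d hd
    rw [Function.iterate_succ_apply', ← stepOp_reflect hρ hn _ hd, ← stepOp_neg]
    exact stepOp_congr ih d

/-- A first-passage argument: once the chain is at or beyond `n / 2`, the remaining mean of `g` is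
at most zero by oddness and monotonicity, so only paths that stay below contribute, each at most
`1`. -/
lemma iterate_stepOp_le_surv (hρ : ρ < 1) (hn : 0 < n) {g : ℕ → ℝ} (hg : Antitone g)
    (hodd : ∀ d ≤ n, g (n - d) = -g d) (h1 : ∀ d, g d ≤ 1) (t d : ℕ) :
    (stepOp n ρ)^[t] g d ≤ surv n ρ t d := by
  have hneg : ∀ t d, ¬ 2 * d < n → (stepOp n ρ)^[t] g d ≤ 0 := by
    intro t d hd
    have ha := iterate_stepOp_antitone (n := n) (ρ := ρ) hg t
    have ho := iterate_stepOp_odd hρ hn hodd t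
    -- Oddness is known only up to `n`, whereas `d` is any natural number; truncation at `n`
    -- suffices by antitonicity. There the value is at most its reflection, that is, its own
    -- negative.
    have h2 : (stepOp n ρ)^[t] g (min d n) ≤ 0 := by
      have h3 := ho (min d n) (min_le_right _ _)
      have h4 := ha (show n - min d n ≤ min d n by omega)
      linarith
    exact (ha (min_le_left d n)).trans h2
  induction t generalizing d with
  | zero =>
    by_cases hd : 2 * d < n
    · simpa [surv, below, hd] using h1 d
    · simpa [surv, below, hd] using hneg 0 d hd
  | succ t ih =>
    by_cases hd : 2 * d < n
    · rw [Function.iterate_succ_apply']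
      simpa [surv, below, hd] using stepOp_le (n := n) (ρ := ρ) (fun e _ => ih e) d
    · simpa [surv, below, hd] using hneg (t + 1) d hd

/-- An odd antitone function of the overlap chain has small mean once the chain is likely to have
passed `n / 2`. -/
lemma abs_iterate_stepOp_le (hρ : ρ < 1) {g : ℕ → ℝ} (hg : Antitone g)
    (hodd : ∀ d ≤ n, g (n - d) = -g d) (h1 : ∀ d, g d ≤ 1) (t : ℕ) {d : ℕ} (hd : 1 ≤ d)
    (hdn : d < n) : |(stepOp n ρ)^[t] g d| ≤ surv n ρ t 1 := by
  have hn : 0 < n := by omega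
  have ha := iterate_stepOp_antitone (n := n) (ρ := ρ) hg t
  have ho := iterate_stepOp_odd hρ hn hodd t d hdn.le
  have key := iterate_stepOp_le_surv hρ hn hg hodd h1 t
  rw [abs_le]
  constructor
  · have := (key (n - d)).trans (surv_antitone t (show 1 ≤ n - d by omega))
    linarith
  · exact (key d).trans (surv_antitone t hd)

/-! ### Restarts after failed climbs, and the climb through levels. -/

/-- The probability that two inputs at distance one are identified by one layer. -/
def mergeProb (n : ℕ) (ρ : ℝ) : ℝ := stepOp n ρ (fun e => if e = 0 then 1 else 0) 1

lemma mergeProb_nonneg : 0 ≤ mergeProb n ρ :=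
  stepOp_nonneg (fun e => by split_ifs <;> simp) 1

/-- After `k` steps the chain is either at a positive distance, where survival for another `t` steps
is at most as likely as from `1`, or it has merged. By monotonicity a merging step from any positive
distance is at most as likely as from `1`, which costs `mergeProb` for each of the `k` steps. -/
lemma surv_add_le (t k : ℕ) {d : ℕ} (hd : 1 ≤ d) :
    surv n ρ (t + k) d ≤ surv n ρ t 1 * surv n ρ k d + k * mergeProb n ρ := by
  induction k generalizing d with
  | zero =>
    have h0 := surv_nonneg (n := n) (ρ := ρ) t 1
    have h1 := surv_antitone (n := n) (ρ := ρ) t hd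
    have h2 := surv_le_below (n := n) (ρ := ρ) t d
    simp only [add_zero, surv, Nat.cast_zero, zero_mul]
    by_cases hb : 2 * d < n
    · simpa [below, hb] using h1
    · simpa [below, hb] using h2
  | succ k ih =>
    have hz : Antitone fun e : ℕ => if e = 0 then (1 : ℝ) else 0 := by
      intro a b hab
      rcases Nat.eq_zero_or_pos a with rfl | ha
      · dsimp; split_ifs <;> simp
      · simp [ha.ne', (ha.trans_le hab).ne']
    have h1 : stepOp n ρ (surv n ρ (t + k)) d ≤
        stepOp n ρ (fun e => (surv n ρ t 1 * surv n ρ k e + (if e = 0 then (1 : ℝ) else 0))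
          + k * mergeProb n ρ) d := by
      refine stepOp_le (fun e _ => ?_) d
      have hm := mul_nonneg (Nat.cast_nonneg (α := ℝ) k) (mergeProb_nonneg (n := n) (ρ := ρ))
      rcases Nat.eq_zero_or_pos e with rfl | he
      · have h2 := surv_le_one (n := n) (ρ := ρ) (t + k) 0
        have h3 := mul_nonneg (surv_nonneg (n := n) (ρ := ρ) t 1)
          (surv_nonneg (n := n) (ρ := ρ) k 0)
        simp only [if_true]; linarith
      · simpa [he.ne'] using ih he
    rw [stepOp_add, stepOp_add, stepOp_const_mul, stepOp_const] at h1
    have h4 : stepOp n ρ (fun e => if e = 0 then (1 : ℝ) else 0) d ≤ mergeProb n ρ :=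
      stepOp_antitone hz hd
    have h5 := mergeProb_nonneg (n := n) (ρ := ρ)
    have h6 := below_nonneg n d
    have h7 := below_le_one n d
    calc surv n ρ (t + (k + 1)) d = below n d * stepOp n ρ (surv n ρ (t + k)) d := rfl
      _ ≤ below n d * (surv n ρ t 1 * stepOp n ρ (surv n ρ k) d + (k + 1) * mergeProb n ρ) := by
        gcongr; linarith
      _ = surv n ρ t 1 * surv n ρ (k + 1) d + below n d * ((k + 1) * mergeProb n ρ) := by
        simp only [surv]; ring
      _ ≤ surv n ρ t 1 * surv n ρ (k + 1) d + ((k + 1 : ℕ) : ℝ) * mergeProb n ρ := by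
        push_cast
        have : below n d * ((k + 1) * mergeProb n ρ) ≤ (k + 1) * mergeProb n ρ :=
          mul_le_of_le_one_left (by positivity) h7
        linarith

lemma surv_mul_le (k m : ℕ) :
    surv n ρ (m * k) 1 ≤ surv n ρ k 1 ^ m + m * k * mergeProb n ρ := by
  induction m with
  | zero => simpa using surv_le_one 0 1
  | succ m ih =>
    have h := surv_add_le (n := n) (ρ := ρ) (m * k) k le_rfl
    have h0 := surv_nonneg (n := n) (ρ := ρ) k 1
    have h1 := surv_le_one (n := n) (ρ := ρ) k 1
    have h2 : (0 : ℝ) ≤ m * k * mergeProb n ρ := by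
      have := mergeProb_nonneg (n := n) (ρ := ρ); positivity
    rw [Nat.succ_mul, pow_succ]
    push_cast
    nlinarith [mul_le_mul_of_nonneg_right ih h0, mul_le_of_le_one_right h2 h1]

/-- If the chain climbs through the levels `a k ≤ ⋯ ≤ a 0` with probability at least `p` each, and
from `a 0` passes `n / 2` with probability at least `q`, it does so within `k + 1` steps with
probability at least `p ^ k * q`. -/
lemma surv_le_of_levels {a : ℕ → ℝ} {p q : ℝ} (hp : 0 ≤ p) (hq : 0 ≤ q) (k : ℕ)
    (hstep : ∀ i < k, ∀ d ≤ n, a (i + 1) ≤ d →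
      p ≤ (noiseLaw n).real {ξ | a i ≤ crossCount n ρ d ξ})
    (hlast : ∀ d ≤ n, a 0 ≤ d → q ≤ (noiseLaw n).real {ξ | n ≤ 2 * crossCount n ρ d ξ}) :
    ∀ d ≤ n, a k ≤ d → surv n ρ (k + 1) d ≤ 1 - p ^ k * q := by
  classical
  induction k with
  | zero =>
    intro d hd had
    have h1 := surv_succ_le_stepOp (n := n) (ρ := ρ) 0 d
    have h2 : stepOp n ρ (fun e => surv n ρ 0 e + (if n ≤ 2 * e then 1 else 0)) d
        = stepOp n ρ (fun _ => 1) d := by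
      refine stepOp_congr (fun e _ => ?_) d
      simp only [surv, below]
      split_ifs <;> first | omega | simp
    rw [stepOp_add, stepOp_const, stepOp_indicator (fun e => n ≤ 2 * e)] at h2
    have := hlast d hd had
    simp only [zero_add] at *
    linarith
  | succ k ih =>
    have ih' := ih fun i hi => hstep i (by omega)
    intro d hd had
    have h1 := surv_succ_le_stepOp (n := n) (ρ := ρ) (k + 1) d
    have h2 : stepOp n ρ (fun e => surv n ρ (k + 1) e + p ^ k * q * (if a k ≤ e then 1 else 0)) d
        ≤ stepOp n ρ (fun _ => 1) d := by
      refine stepOp_le (fun e he => ?_) d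
      split_ifs with hae
      · linarith [ih' e he hae]
      · linarith [surv_le_one (n := n) (ρ := ρ) (k + 1) e]
    rw [stepOp_add, stepOp_const, stepOp_const_mul, stepOp_indicator (fun e : ℕ => a k ≤ e)] at h2
    have h3 := hstep k (Nat.lt_succ_self k) d hd had
    have h4 : p ^ k * q * p ≤ p ^ k * q * (noiseLaw n).real {ξ | a k ≤ crossCount n ρ d ξ} := by
      gcongr
    rw [pow_succ]
    linarith

/-! ### Elementary Gaussian estimates. -/

lemma gauss_ball_lower (u : ℝ) {r : ℝ} (hr : 0 < r) (hr1 : r ≤ 1) :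
    r / 2 * Real.exp (-(|u| + 1) ^ 2 / 2) ≤ (gaussianReal 0 1).real {x | |u + x| < r} := by
  have hS : {x : ℝ | |u + x| < r} = Set.Ioo (-u - r) (-u + r) := by
    ext x
    simp only [Set.mem_ofPred_eq, Set.mem_Ioo, abs_lt]
    constructor <;> rintro ⟨h1, h2⟩ <;> constructor <;> linarith
  have hpi : √(2 * Real.pi) ≤ 4 := by
    rw [Real.sqrt_le_left (by norm_num)]
    have := Real.pi_le_four; linarith
  have hpos : 0 < √(2 * Real.pi) := by positivity
  have h1 : ∀ x ∈ Set.Ioo (-u - r) (-u + r),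
      1 / 4 * Real.exp (-(|u| + 1) ^ 2 / 2) ≤ gaussianPDFReal 0 1 x := by
    intro x hx
    have hx' : |x| ≤ |u| + 1 := by
      have h3 : |u + x| < r := by rw [← hS] at hx; exact hx
      calc |x| = |(u + x) - u| := by ring_nf
        _ ≤ |u + x| + |u| := abs_sub _ _
        _ ≤ |u| + 1 := by linarith
    have h4 : x ^ 2 ≤ (|u| + 1) ^ 2 := by
      rw [← sq_abs x]; gcongr
    simp only [gaussianPDFReal, NNReal.coe_one, mul_one, sub_zero]
    gcongr
    rw [one_div]
    gcongr
  rw [hS, Measure.real, gaussianReal_apply_eq_integral _ one_ne_zero,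
    ENNReal.toReal_ofReal (integral_nonneg fun x => gaussianPDFReal_nonneg 0 1 x)]
  calc r / 2 * Real.exp (-(|u| + 1) ^ 2 / 2)
      = ∫ x in Set.Ioo (-u - r) (-u + r), 1 / 4 * Real.exp (-(|u| + 1) ^ 2 / 2) := by
        rw [setIntegral_const, Measure.real, Real.volume_Ioo, ENNReal.toReal_ofReal (by linarith),
          smul_eq_mul]
        ring
    _ ≤ _ := setIntegral_mono_on (integrableOn_const (by simp))
        (integrable_gaussianPDFReal 0 1).integrableOn measurableSet_Ioo h1

lemma gauss_ball_upper {r : ℝ} (hr : 0 ≤ r) : (gaussianReal 0 1).real {x | |x| < r} ≤ 2 * r := by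
  have hS : {x : ℝ | |x| < r} = Set.Ioo (-r) r := by
    ext x; simp [abs_lt]
  rw [hS, Measure.real, gaussianReal_apply_eq_integral _ one_ne_zero,
    ENNReal.toReal_ofReal (integral_nonneg fun x => gaussianPDFReal_nonneg 0 1 x)]
  calc _ ≤ ∫ x in Set.Ioo (-r) r, (1 : ℝ) := by
        refine setIntegral_mono_on (integrable_gaussianPDFReal 0 1).integrableOn
          (integrableOn_const (by simp))
          measurableSet_Ioo fun x _ => ?_
        simp only [gaussianPDFReal, NNReal.coe_one, mul_one, sub_zero]
        have h1 : (√(2 * Real.pi))⁻¹ ≤ 1 := by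
          refine inv_le_one_of_one_le₀ (Real.one_le_sqrt.2 ?_)
          have := Real.pi_gt_three; linarith
        have h2 : Real.exp (-x ^ 2 / 2) ≤ 1 := Real.exp_le_one_iff.2 (by nlinarith [sq_nonneg x])
        exact mul_le_one₀ h1 (Real.exp_pos _).le h2
    _ = 2 * r := by
        rw [setIntegral_const, Measure.real, Real.volume_Ioo, ENNReal.toReal_ofReal (by linarith),
          smul_eq_mul]
        ring

lemma gauss_tail {R : ℝ} (hR : 0 ≤ R) :
    (gaussianReal 0 1).real {x | R < |x|} ≤ 2 * Real.exp (-R ^ 2 / 2) := by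
  have h1 : (gaussianReal 0 1).real {x | R ≤ x} ≤ Real.exp (-R ^ 2 / 2) := by
    refine (measure_ge_le_exp_mul_mgf R hR (integrable_exp_mul_gaussianReal R)).trans_eq ?_
    rw [mgf_fun_id_gaussianReal, ← Real.exp_add]
    congr 1; simp; ring
  have h2 : (gaussianReal 0 1).real {x | x ≤ -R} ≤ Real.exp (-R ^ 2 / 2) := by
    refine (measure_le_le_exp_mul_mgf (-R) (neg_nonpos.2 hR)
      (integrable_exp_mul_gaussianReal (-R))).trans_eq ?_
    rw [mgf_fun_id_gaussianReal, ← Real.exp_add]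
    congr 1; simp; ring
  calc _ ≤ (gaussianReal 0 1).real ({x | R ≤ x} ∪ {x | x ≤ -R}) := by
        refine measureReal_mono fun x hx => ?_
        rcases lt_abs.1 (show R < |x| from hx) with h | h
        · exact Or.inl h.le
        · exact Or.inr (show x ≤ -R by linarith)
    _ ≤ _ := (measureReal_union_le _ _).trans (by linarith)

/-! ### Counts of independent events. -/

/-- The number of coordinates that fall into `E`. -/
def countIn {α : Type*} (E : Set α) [DecidablePred (· ∈ E)] (w : Fin n → α) : ℕ :=
  (Finset.univ.filter fun i => w i ∈ E).card

section Count

variable {α : Type*} {E : Set α} [DecidablePred (· ∈ E)]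

lemma countIn_eq_sum (w : Fin n → α) : countIn E w = ∑ i, if w i ∈ E then 1 else 0 :=
  Finset.card_filter _ _

variable [MeasurableSpace α] {μ : Measure α} [IsProbabilityMeasure μ]

lemma measurable_countIn (hE : MeasurableSet E) : Measurable (countIn (n := n) E) := by
  have : countIn (n := n) E = fun w => ∑ i, if w i ∈ E then 1 else 0 :=
    funext countIn_eq_sum
  rw [this]
  exact Finset.measurable_sum _ fun i _ => Measurable.ite (measurable_pi_apply i hE)
    measurable_const measurable_const

/-- Chernoff's bound with parameter one: `1 - exp(-1) ≥ 1/2` bounds the mean of `exp(-N)` for the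
count `N` by `exp(-nq/2)`, and Markov's inequality gives back half of the exponent. -/
lemma countIn_lower_tail (hE : MeasurableSet E) {q : ℝ} (hq : q ≤ μ.real E) :
    (Measure.pi fun _ : Fin n => μ).real {w | (countIn E w : ℝ) < n * q / 4}
      ≤ Real.exp (-(n * q / 4)) := by
  have hexp : ∀ w : Fin n → α, Real.exp (-(countIn E w : ℝ))
      = ∏ i, if w i ∈ E then Real.exp (-1) else 1 := by
    intro w
    rw [countIn_eq_sum]
    push_cast
    rw [← Finset.sum_neg_distrib, Real.exp_sum]
    refine Finset.prod_congr rfl fun i _ => ?_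
    split_ifs <;> simp
  have hint : ∫ w, Real.exp (-(countIn E w : ℝ)) ∂(Measure.pi fun _ : Fin n => μ)
      ≤ Real.exp (-(n * q / 2)) := by
    simp only [hexp]
    rw [integral_fintype_prod_eq_prod (f := fun (_ : Fin n) (x : α) =>
      if x ∈ E then Real.exp (-1) else (1 : ℝ))]
    have h1 : ∫ x, (if x ∈ E then Real.exp (-1) else (1 : ℝ)) ∂μ
        = 1 - (1 - Real.exp (-1)) * μ.real E := by
      have : (fun x => if x ∈ E then Real.exp (-1) else (1 : ℝ))
          = fun x => 1 - (1 - Real.exp (-1)) * E.indicator (fun _ => (1 : ℝ)) x := by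
        ext x; by_cases hx : x ∈ E <;> simp [hx]
      rw [this, integral_sub (integrable_const _)
        (((integrable_const (1 : ℝ)).indicator hE).const_mul _), integral_const_mul,
        integral_indicator_const _ hE]
      simp
    have h2 : 1 - (1 - Real.exp (-1)) * μ.real E ≤ Real.exp (-(q / 2)) := by
      have h3 : Real.exp (-1) ≤ 1 / 2 := by
        rw [Real.exp_neg, one_div]
        refine inv_anti₀ (by norm_num) ?_
        have := Real.add_one_le_exp (1 : ℝ); linarith
      have h4 := Real.add_one_le_exp (-(q / 2))
      have h5 : (0 : ℝ) ≤ μ.real E := measureReal_nonneg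
      nlinarith
    have h0 : 0 ≤ 1 - (1 - Real.exp (-1)) * μ.real E := by
      rw [← h1]; exact integral_nonneg fun x => by dsimp; split_ifs <;> positivity
    rw [Finset.prod_const, h1, Finset.card_univ, Fintype.card_fin]
    calc _ ≤ Real.exp (-(q / 2)) ^ n := by gcongr
      _ = Real.exp (-(n * q / 2)) := by rw [← Real.exp_nat_mul]; congr 1; ring
  have hi : Integrable (fun w => Real.exp (-(countIn E w : ℝ))) (Measure.pi fun _ : Fin n => μ) :=
    integrable_of_nat_le (measurable_countIn hE) (n := n)
      (fun w => (Finset.card_le_univ _).trans (by simp)) fun k => Real.exp (-(k : ℝ))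
  have hm := mul_meas_ge_le_integral_of_nonneg (ae_of_all _ fun w => (Real.exp_pos _).le) hi
    (Real.exp (-(n * q / 4)))
  have hsub : (Measure.pi fun _ : Fin n => μ).real {w | (countIn E w : ℝ) < n * q / 4} ≤
      (Measure.pi fun _ : Fin n => μ).real
        {w | Real.exp (-(n * q / 4)) ≤ Real.exp (-(countIn E w : ℝ))} := by
    refine measureReal_mono fun w hw => ?_
    simp only [Set.mem_ofPred_eq, Real.exp_le_exp] at hw ⊢
    linarith
  refine hsub.trans ?_
  have h6 := hm.trans hint
  have h7 : Real.exp (-(n * q / 2)) = Real.exp (-(n * q / 4)) * Real.exp (-(n * q / 4)) := by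
    rw [← Real.exp_add]; congr 1; ring
  rw [h7] at h6
  exact le_of_mul_le_mul_left h6 (Real.exp_pos _)

/-- The number of coordinates outside `E` has mean at most `n / 8`, so by Markov's inequality it
reaches `n / 2` with probability at most `1 / 4`. -/
lemma countIn_half (hE : MeasurableSet E) (hn : 0 < n) (hq : 7 / 8 ≤ μ.real E) :
    3 / 4 ≤ (Measure.pi fun _ : Fin n => μ).real {w | n ≤ 2 * countIn E w} := by
  have hn' : (0 : ℝ) < n := by exact_mod_cast hn
  have hle : ∀ w : Fin n → α, countIn E w ≤ n := fun w =>
    (Finset.card_le_univ _).trans (by simp)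
  have hi : Integrable (fun w => (n : ℝ) - (countIn E w : ℝ)) (Measure.pi fun _ : Fin n => μ) :=
    integrable_of_nat_le (measurable_countIn hE) hle fun k => (n : ℝ) - k
  have hint : ∫ w, ((n : ℝ) - (countIn E w : ℝ)) ∂(Measure.pi fun _ : Fin n => μ) ≤ n / 8 := by
    rw [integral_sub (integrable_const _) (integrable_of_nat_le (measurable_countIn hE) hle
      fun k => (k : ℝ))]
    have h1 : ∀ w : Fin n → α, (countIn E w : ℝ) = ∑ i, E.indicator (1 : α → ℝ) (w i) := by
      intro w
      rw [countIn_eq_sum]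
      push_cast
      refine Finset.sum_congr rfl fun i _ => ?_
      by_cases h : w i ∈ E <;> simp [h]
    have h2 : ∫ w, (countIn E w : ℝ) ∂(Measure.pi fun _ : Fin n => μ) = n * μ.real E := by
      simp only [h1]
      rw [integral_finsetSum]
      · have h3 : ∀ i : Fin n, ∫ w, E.indicator (1 : α → ℝ) (w i) ∂(Measure.pi fun _ : Fin n => μ)
            = μ.real E := fun i => by
          have h3 := integral_map (μ := Measure.pi fun _ : Fin n => μ)
            (measurable_pi_apply i).aemeasurable
            ((measurable_one (α := ℝ)).indicator hE).aestronglyMeasurable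
          rw [← h3]
          have h4 : (Measure.pi fun _ : Fin n => μ).map (fun w => w i) = μ :=
            (measurePreserving_eval (fun _ : Fin n => μ) i).map_eq
          rw [h4, integral_indicator_one hE]
        simp [h3]
      · intro i _
        exact (measurePreserving_eval (fun _ : Fin n => μ) i).integrable_comp_of_integrable
          ((integrable_const (1 : ℝ)).indicator hE)
    rw [h2]
    simp
    nlinarith
  have hm := mul_meas_ge_le_integral_of_nonneg (ae_of_all _ fun w => by
    have : (countIn E w : ℝ) ≤ n := by exact_mod_cast hle w
    simpa using this) hi (n / 2 : ℝ)
  have h4 : (Measure.pi fun _ : Fin n => μ).real {w | (n / 2 : ℝ) ≤ n - (countIn E w : ℝ)}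
      ≤ 1 / 4 := by
    have := hm.trans hint
    by_contra! hc
    nlinarith
  have hms : MeasurableSet {w : Fin n → α | n ≤ 2 * countIn E w} :=
    measurable_countIn hE (MeasurableSet.of_discrete (s := {e | n ≤ 2 * e}))
  have h5 := probReal_compl_eq_one_sub (μ := Measure.pi fun _ : Fin n => μ) hms
  have h6 : (Measure.pi fun _ : Fin n => μ).real {w : Fin n → α | n ≤ 2 * countIn E w}ᶜ ≤ 1 / 4 := by
    refine le_trans (measureReal_mono fun w hw => ?_) h4
    simp only [Set.mem_compl_iff, Set.mem_ofPred_eq, not_le] at hw ⊢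
    have : (2 * countIn E w : ℝ) ≤ n := by exact_mod_cast hw.le
    linarith
  linarith

end Count

/-! ### Conditioning on the common noise. -/

section Fubini

variable {α β : Type*} [MeasurableSpace α] [MeasurableSpace β] {μ : Measure α} {ν : Measure β}
  [IsProbabilityMeasure μ] [IsProbabilityMeasure ν]

lemma mul_le_prod_real {S : Set (α × β)} (hS : MeasurableSet S) {A : Set α} (hA : MeasurableSet A)
    {q : ℝ} (h : ∀ z ∈ A, q ≤ ν.real {w | (z, w) ∈ S}) : μ.real A * q ≤ (μ.prod ν).real S := by
  have h1 : (μ.prod ν).real S = ∫ z, ν.real {w | (z, w) ∈ S} ∂μ := by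
    have hm : Measurable fun z => ν.real {w | (z, w) ∈ S} :=
      (measurable_measure_prodMk_left hS).ennreal_toReal
    rw [Measure.real, Measure.prod_apply hS, integral_eq_lintegral_of_nonneg_ae
      (ae_of_all _ fun _ => measureReal_nonneg)
      hm.aestronglyMeasurable]
    congr 1
    refine lintegral_congr fun z => ?_
    simp only [Measure.real]
    rw [ENNReal.ofReal_toReal (measure_ne_top _ _)]
    rfl
  rw [h1, ← smul_eq_mul, ← integral_indicator_const q hA]
  refine integral_mono ((integrable_const q).indicator hA) ?_ fun z => ?_
  · exact Integrable.of_bound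
      (measurable_measure_prodMk_left hS).ennreal_toReal.aestronglyMeasurable 1
      (ae_of_all _ fun z => by
        rw [Real.norm_of_nonneg measureReal_nonneg]; exact measureReal_le_one)
  · by_cases hz : z ∈ A
    · simpa [hz] using h z hz
    · simp [hz]

lemma prod_real_le_add {S : Set (α × β)} (hS : MeasurableSet S) {A : Set α} (hA : MeasurableSet A)
    {q : ℝ} (hq : 0 ≤ q) (h : ∀ z ∈ A, ν.real {w | (z, w) ∈ S} ≤ q) :
    (μ.prod ν).real S ≤ μ.real Aᶜ + q := by
  have h1 := mul_le_prod_real (μ := μ) (ν := ν) hS.compl hA (q := 1 - q) fun z hz => by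
    have h3 : {w | (z, w) ∈ Sᶜ} = {w | (z, w) ∈ S}ᶜ := rfl
    have hm : MeasurableSet {w | (z, w) ∈ S} := measurable_prodMk_left hS
    rw [h3, probReal_compl_eq_one_sub hm]
    linarith [h z hz]
  rw [probReal_compl_eq_one_sub hS] at h1
  rw [probReal_compl_eq_one_sub hA]
  have h2 : μ.real A ≤ 1 := measureReal_le_one
  nlinarith

end Fubini

/-! ### One-step estimates: growth, merging and the jump past `n / 2`. -/

/-- The row noises for which the row separates the two inputs, given the common noise `z`. -/
def crossSet (ρ a : ℝ) (z : ℝ × ℝ) : Set (ℝ × ℝ) :=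
  {w | Crossing a (√ρ * z.1 + √(1 - ρ) * w.1) (√ρ * z.2 + √(1 - ρ) * w.2)}

instance (ρ a : ℝ) (z : ℝ × ℝ) : DecidablePred (· ∈ crossSet ρ a z) := fun w =>
  inferInstanceAs (Decidable (Crossing a (√ρ * z.1 + √(1 - ρ) * w.1) (√ρ * z.2 + √(1 - ρ) * w.2)))

lemma measurableSet_crossSet (ρ a : ℝ) (z : ℝ × ℝ) : MeasurableSet (crossSet ρ a z) :=
  (measurableSet_eq_fun (f := fun w : ℝ × ℝ => sgn _) (by fun_prop) (by fun_prop)).compl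

lemma crossCount_eq_countIn (d : ℕ) (z : ℝ × ℝ) (w : Fin n → ℝ × ℝ) :
    crossCount n ρ d (z, w) = countIn (crossSet ρ ((d : ℝ) / n) z) w := by
  unfold crossCount countIn crossSet
  congr

lemma measurableSet_crossCount (d : ℕ) (s : Set ℕ) :
    MeasurableSet {ξ : (ℝ × ℝ) × (Fin n → ℝ × ℝ) | crossCount n ρ d ξ ∈ s} :=
  measurable_crossCount n ρ d (MeasurableSet.of_discrete (s := s))

lemma crossing_of_abs_lt {a u v : ℝ} (ha : 0 ≤ a) (h : |u| < √a * |v|) : Crossing a u v := by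
  apply sgn_add_ne_sgn_sub_of_abs_lt
  rw [abs_mul, abs_mul, abs_of_nonneg (Real.sqrt_nonneg _), abs_of_nonneg (Real.sqrt_nonneg _)]
  have h1 : √(1 - a) ≤ 1 := Real.sqrt_le_one.2 (by linarith)
  exact (mul_le_of_le_one_left (abs_nonneg u) h1).trans_lt h

lemma gauss2_real_prod (s t : Set ℝ) :
    gauss2.real (s ×ˢ t) = (gaussianReal 0 1).real s * (gaussianReal 0 1).real t :=
  measureReal_prod_prod s t

/-- It suffices that the first row Gaussian cancels the common part up to `√a` and that the second
has the sign of `z.2` and size at least `1`. The first event costs the factor `√a` and the Gaussian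
weight of the shift by `z.1`; the second, with `w.2` within `1` of `±2`, has probability at least
`exp(-9/2) / 2`. -/
lemma crossSet_lower (hρ : ρ < 1) {a : ℝ} (ha : 0 < a) (ha1 : a ≤ 1) (z : ℝ × ℝ) :
    Real.exp (-9 / 2) / 4 * √a * Real.exp (-(√ρ / √(1 - ρ) * |z.1| + 1) ^ 2 / 2)
      ≤ gauss2.real (crossSet ρ a z) := by
  have hs : 0 < √(1 - ρ) := Real.sqrt_pos.2 (by linarith)
  obtain ⟨σ, hσ, hσz⟩ : ∃ σ : ℝ, |σ| = 1 ∧ 0 ≤ σ * z.2 := by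
    rcases le_total 0 z.2 with h | h
    · exact ⟨1, by simp, by simpa⟩
    · exact ⟨-1, by simp, by simpa⟩
  have hsub : {x | |√ρ / √(1 - ρ) * z.1 + x| < √a} ×ˢ {x | |-2 * σ + x| < 1}
      ⊆ crossSet ρ a z := by
    rintro ⟨w1, w2⟩ ⟨h1, h2⟩
    change |√ρ / √(1 - ρ) * z.1 + w1| < √a at h1
    change |-2 * σ + w2| < 1 at h2
    refine crossing_of_abs_lt ha.le ?_
    dsimp only
    have h3 : √ρ * z.1 + √(1 - ρ) * w1 = √(1 - ρ) * (√ρ / √(1 - ρ) * z.1 + w1) := by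
      field_simp
    have hσ2 : σ * σ = 1 := by rw [← abs_mul_abs_self, hσ, one_mul]
    have h4 : 1 ≤ σ * w2 := by
      have h5 : |σ * (-2 * σ + w2)| < 1 := by rw [abs_mul, hσ, one_mul]; exact h2
      have h6 := (abs_lt.1 h5).1
      nlinarith
    have h7 : √(1 - ρ) ≤ |√ρ * z.2 + √(1 - ρ) * w2| := by
      calc √(1 - ρ) ≤ √ρ * (σ * z.2) + √(1 - ρ) * (σ * w2) := by
            have := mul_nonneg (Real.sqrt_nonneg ρ) hσz
            nlinarith
        _ = σ * (√ρ * z.2 + √(1 - ρ) * w2) := by ring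
        _ ≤ |σ * (√ρ * z.2 + √(1 - ρ) * w2)| := le_abs_self _
        _ = _ := by rw [abs_mul, hσ, one_mul]
    rw [h3, abs_mul, abs_of_pos hs]
    calc _ < √(1 - ρ) * √a := by gcongr
      _ = √a * √(1 - ρ) := mul_comm _ _
      _ ≤ _ := by gcongr
  refine le_trans ?_ (measureReal_mono hsub)
  rw [gauss2_real_prod]
  have h1 := gauss_ball_lower (√ρ / √(1 - ρ) * z.1) (Real.sqrt_pos.2 ha) (Real.sqrt_le_one.2 ha1)
  have h2 := gauss_ball_lower (-2 * σ) one_pos le_rfl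
  rw [abs_mul, abs_of_nonneg (show 0 ≤ √ρ / √(1 - ρ) by positivity)] at h1
  rw [abs_mul, hσ, show -(|(-2 : ℝ)| * 1 + 1) ^ 2 / 2 = -9 / 2 by norm_num] at h2
  calc _ = (√a / 2 * Real.exp (-(√ρ / √(1 - ρ) * |z.1| + 1) ^ 2 / 2))
        * (1 / 2 * Real.exp (-9 / 2)) := by ring
    _ ≤ _ := by
      exact mul_le_mul h1 h2 (by positivity) measureReal_nonneg

lemma sqrt_div_mul_self {d : ℕ} : (n : ℝ) * √((d : ℝ) / n) = √((d : ℝ) * n) := by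
  rcases Nat.eq_zero_or_pos n with rfl | hn
  · simp
  have hn' : (0 : ℝ) < n := by exact_mod_cast hn
  rw [Real.sqrt_div' _ hn'.le, Real.sqrt_mul' _ hn'.le]
  have h2 := (Real.sqrt_pos.2 hn').ne'
  field_simp
  rw [Real.sq_sqrt hn'.le, mul_comm]

/-- Conditionally on `z.1` not being large, the number of separated rows is at least a constant
times its typical size. -/
lemma crossCount_section_tail (hρ : ρ < 1) {d : ℕ} (hd : 1 ≤ d) (hdn : d ≤ n) {R : ℝ}
    {z : ℝ × ℝ} (hz : √ρ / √(1 - ρ) * |z.1| ≤ R) :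
    (Measure.pi fun _ : Fin n => gauss2).real {w | (crossCount n ρ d (z, w) : ℝ) <
        Real.exp (-9 / 2) / 16 * Real.exp (-(R + 1) ^ 2 / 2) * √((d : ℝ) * n)}
      ≤ Real.exp (-(Real.exp (-9 / 2) / 16 * Real.exp (-(R + 1) ^ 2 / 2) * √((d : ℝ) * n))) := by
  have hn : (0 : ℝ) < n := by exact_mod_cast hd.trans hdn
  have hd' : (0 : ℝ) < d := by exact_mod_cast hd
  have ha1 : (d : ℝ) / n ≤ 1 := by rw [div_le_one hn]; exact_mod_cast hdn
  have h1 := crossSet_lower hρ (div_pos hd' hn) ha1 z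
  have h2 : Real.exp (-9 / 2) / 4 * √((d : ℝ) / n) * Real.exp (-(R + 1) ^ 2 / 2) ≤
      gauss2.real (crossSet ρ ((d : ℝ) / n) z) := by
    refine le_trans ?_ h1
    have : 0 ≤ √ρ / √(1 - ρ) * |z.1| := by positivity
    gcongr
  have h3 := countIn_lower_tail (n := n) (measurableSet_crossSet ρ ((d : ℝ) / n) z) h2
  have h4 : (n : ℝ) * (Real.exp (-9 / 2) / 4 * √((d : ℝ) / n) * Real.exp (-(R + 1) ^ 2 / 2)) / 4
      = Real.exp (-9 / 2) / 16 * Real.exp (-(R + 1) ^ 2 / 2) * √((d : ℝ) * n) := by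
    rw [← sqrt_div_mul_self]; ring
  rw [h4] at h3
  simp only [crossCount_eq_countIn]
  exact h3

/-- The constant of proportionality in the growth of the overlap chain. -/
def growth : ℝ := Real.exp (-9 / 2) / 16 * Real.exp (-2)

lemma growth_pos : 0 < growth := by unfold growth; positivity

/-- The common Gaussian is asked to satisfy `|z.1| < r`, which bounds its rescaled effect by `1`.
Then `crossCount_section_tail` with `R = 1` yields the constant `growth` and a conditional failure
probability of at most `exp(-1) ≤ 1/2`. -/
lemma crossCount_step (hρ : ρ < 1) {d : ℕ} (hd : 1 ≤ d) (hdn : d ≤ n) (hn : 1 ≤ growth * √n)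
    {r : ℝ} (hr : 0 < r) (hr1 : r ≤ 1) (hκ : √ρ / √(1 - ρ) * r ≤ 1) :
    r / 4 * Real.exp (-1 / 2) ≤
      (noiseLaw n).real {ξ | growth * √((d : ℝ) * n) ≤ crossCount n ρ d ξ} := by
  have hS := measurableSet_crossCount (n := n) (ρ := ρ) d {e | growth * √((d : ℝ) * n) ≤ (e : ℝ)}
  have hA : MeasurableSet {z : ℝ × ℝ | |0 + z.1| < r} :=
    measurableSet_lt (by fun_prop) measurable_const
  have h1 := mul_le_prod_real (μ := gauss2) (ν := Measure.pi fun _ : Fin n => gauss2) hS hA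
    (q := 1 / 2) fun z hz => by
      have hz' : |z.1| < r := by
        have : |0 + z.1| < r := hz
        rwa [zero_add] at this
      have h2 : √ρ / √(1 - ρ) * |z.1| ≤ 1 := by
        refine le_trans ?_ hκ; gcongr
      have h3 := crossCount_section_tail hρ hd hdn h2
      have h4 : Real.exp (-9 / 2) / 16 * Real.exp (-((1 : ℝ) + 1) ^ 2 / 2) = growth := by
        unfold growth; norm_num
      rw [h4] at h3
      have h5 : {w : Fin n → ℝ × ℝ | (crossCount n ρ d (z, w) : ℝ) < growth * √((d : ℝ) * n)}
          = {w | (z, w) ∈ {ξ : (ℝ × ℝ) × (Fin n → ℝ × ℝ) | crossCount n ρ d ξ ∈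
            {e : ℕ | growth * √((d : ℝ) * n) ≤ (e : ℝ)}}}ᶜ := by
        ext w; simp
      have hm : MeasurableSet {w | (z, w) ∈ {ξ : (ℝ × ℝ) × (Fin n → ℝ × ℝ) |
          crossCount n ρ d ξ ∈ {e : ℕ | growth * √((d : ℝ) * n) ≤ (e : ℝ)}}} :=
        measurable_prodMk_left hS
      rw [h5, probReal_compl_eq_one_sub hm] at h3
      have h6 : (1 : ℝ) ≤ growth * √((d : ℝ) * n) := by
        refine hn.trans ?_
        have := growth_pos
        gcongr
        exact le_mul_of_one_le_left (Nat.cast_nonneg n) (by exact_mod_cast hd)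
      have h7 : Real.exp (-(growth * √((d : ℝ) * n))) ≤ 1 / 2 := by
        rw [Real.exp_neg, one_div]
        refine inv_anti₀ (by norm_num) ?_
        have := Real.add_one_le_exp (growth * √((d : ℝ) * n)); linarith
      linarith
  refine le_trans ?_ h1
  have h8 : {z : ℝ × ℝ | |0 + z.1| < r} = {x : ℝ | |0 + x| < r} ×ˢ Set.univ := by
    ext z; simp
  rw [h8, gauss2_real_prod]
  have h9 := gauss_ball_lower 0 hr hr1
  norm_num at h9 ⊢
  linarith

/-- Truncation at `|z.1| ≤ R`: the first term bounds the excluded event, the second is the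
conditional lower tail at `d = 1`. The free parameter `R` balances the two. -/
lemma mergeProb_le (hρ : ρ < 1) (hn : 1 ≤ n) {R : ℝ} (hR : 0 ≤ R) :
    mergeProb n ρ ≤ 2 * Real.exp (-R ^ 2 / 2) +
      Real.exp (-(Real.exp (-9 / 2) / 16 * Real.exp (-(√ρ / √(1 - ρ) * R + 1) ^ 2 / 2) * √n)) := by
  have hn' : (0 : ℝ) < n := by exact_mod_cast hn
  have hS := measurableSet_crossCount (n := n) (ρ := ρ) 1 {e | e = 0}
  have hA : MeasurableSet {z : ℝ × ℝ | |z.1| ≤ R} :=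
    measurableSet_le (by fun_prop) measurable_const
  have h1 := prod_real_le_add (μ := gauss2) (ν := Measure.pi fun _ : Fin n => gauss2) hS hA
    (Real.exp_pos _).le fun z hz => by
      have hz' : |z.1| ≤ R := hz
      have h2 : √ρ / √(1 - ρ) * |z.1| ≤ √ρ / √(1 - ρ) * R := by gcongr
      refine le_trans (measureReal_mono fun w hw => ?_)
        (crossCount_section_tail hρ le_rfl hn h2)
      have hw' : crossCount n ρ 1 (z, w) = 0 := hw
      simp only [Set.mem_ofPred_eq, hw', Nat.cast_zero, Nat.cast_one, one_mul]
      positivity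
  have h3 : {z : ℝ × ℝ | |z.1| ≤ R}ᶜ = {x : ℝ | R < |x|} ×ˢ Set.univ := by
    ext z; simp
  rw [h3, gauss2_real_prod] at h1
  have h4 := gauss_tail hR
  simp only [probReal_univ, mul_one, Nat.cast_one, one_mul] at h1
  rw [mergeProb, stepOp_indicator (fun e => e = 0)]
  calc _ ≤ _ := h1
    _ ≤ _ := by gcongr

/-- The probability of a jump over `n / 2` from a macroscopic distance is bounded below. -/
lemma crossCount_jump {δ α : ℝ} (hδ : 0 < δ) (hα : 0 < α) :
    ∃ q > 0, ∀ (n : ℕ) (ρ : ℝ), 0 < n → δ < ρ → ρ < 1 → ∀ d ≤ n, α * n ≤ (d : ℝ) →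
      q ≤ (noiseLaw n).real {ξ | n ≤ 2 * crossCount n ρ d ξ} := by
  -- When `|z1| < 1`, `z2 > R` and the row Gaussians are at most `4` in modulus, the first
  -- combination is at most `5`, and the second is at least `√δ * R - 4 = 5 / √α + 1`, enough to win
  -- after multiplication by `√α`.
  set R : ℝ := (5 / √α + 5) / √δ with hR
  have hR0 : 0 < R := by positivity
  refine ⟨1 / 2 * Real.exp (-(|(0 : ℝ)| + 1) ^ 2 / 2) *
    (1 / 2 * Real.exp (-(|-(R + 1)| + 1) ^ 2 / 2)) * (3 / 4), by positivity, ?_⟩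
  intro n ρ hn hδρ hρ d hdn hd
  have hn' : (0 : ℝ) < n := by exact_mod_cast hn
  have hS := measurableSet_crossCount (n := n) (ρ := ρ) d {e | n ≤ 2 * e}
  have hA : MeasurableSet ({x : ℝ | |0 + x| < 1} ×ˢ {x : ℝ | |-(R + 1) + x| < 1}) :=
    (measurableSet_lt (by fun_prop) measurable_const).prod
      (measurableSet_lt (by fun_prop) measurable_const)
  refine le_trans ?_ (mul_le_prod_real (μ := gauss2) (ν := Measure.pi fun _ : Fin n => gauss2)
    hS hA (q := 3 / 4) ?_)
  · rw [gauss2_real_prod]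
    have h1 := gauss_ball_lower 0 one_pos le_rfl
    have h2 := gauss_ball_lower (-(R + 1)) one_pos le_rfl
    gcongr
  rintro ⟨z1, z2⟩ ⟨h1, h2⟩
  have h1' : |z1| < 1 := by
    have : |0 + z1| < 1 := h1
    rwa [zero_add] at this
  have h2' : R < z2 := by
    have : |-(R + 1) + z2| < 1 := h2
    have := (abs_lt.1 this).1
    linarith
  have hcross : 7 / 8 ≤ gauss2.real (crossSet ρ ((d : ℝ) / n) (z1, z2)) := by
    have hsub : {x : ℝ | 4 < |x|}ᶜ ×ˢ {x : ℝ | 4 < |x|}ᶜ ⊆ crossSet ρ ((d : ℝ) / n) (z1, z2) := by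
      rintro ⟨w1, w2⟩ ⟨h3, h4⟩
      have h3' : |w1| ≤ 4 := not_lt.1 h3
      have h4' : |w2| ≤ 4 := not_lt.1 h4
      refine crossing_of_abs_lt (by positivity) ?_
      dsimp only
      have hs1 : √(1 - ρ) ≤ 1 := Real.sqrt_le_one.2 (by linarith)
      have hr1 : √ρ ≤ 1 := Real.sqrt_le_one.2 hρ.le
      have hrδ : √δ ≤ √ρ := Real.sqrt_le_sqrt hδρ.le
      have hs0 := Real.sqrt_nonneg (1 - ρ)
      have hr0 := Real.sqrt_nonneg ρ
      have ha : √α ≤ √((d : ℝ) / n) := Real.sqrt_le_sqrt (by rwa [le_div_iff₀ hn'])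
      have ha0 := Real.sqrt_pos.2 hα
      have hd0 := Real.sqrt_pos.2 hδ
      have h5 : |√ρ * z1 + √(1 - ρ) * w1| ≤ 5 := by
        calc _ ≤ |√ρ * z1| + |√(1 - ρ) * w1| := abs_add_le _ _
          _ = √ρ * |z1| + √(1 - ρ) * |w1| := by
            rw [abs_mul, abs_mul, abs_of_nonneg hr0, abs_of_nonneg hs0]
          _ ≤ 1 * 1 + 1 * 4 := by gcongr
          _ = 5 := by norm_num
      have h6 : 5 / √α + 1 ≤ |√ρ * z2 + √(1 - ρ) * w2| := by
        have h7 : √(1 - ρ) * |w2| ≤ 1 * 4 := by gcongr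
        have h8 : √(1 - ρ) * (-|w2|) ≤ √(1 - ρ) * w2 :=
          mul_le_mul_of_nonneg_left (neg_abs_le w2) hs0
        have h9 : √δ * R ≤ √ρ * z2 := by gcongr
        have h10 : √δ * R = 5 / √α + 5 := by rw [hR]; field_simp
        have h11 := le_abs_self (√ρ * z2 + √(1 - ρ) * w2)
        linarith
      calc _ ≤ 5 := h5
        _ < √α * (5 / √α + 1) := by
          have : √α * (5 / √α + 1) = 5 + √α := by field_simp
          linarith
        _ ≤ _ := by gcongr
    refine le_trans ?_ (measureReal_mono hsub)
    rw [gauss2_real_prod]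
    have hm : MeasurableSet {x : ℝ | 4 < |x|} := measurableSet_lt measurable_const (by fun_prop)
    rw [probReal_compl_eq_one_sub hm]
    have h3 := gauss_tail (R := 4) (by norm_num)
    have h4 : Real.exp (-(4 : ℝ) ^ 2 / 2) ≤ 1 / 32 := by
      have h5 : Real.exp (-(4 : ℝ) ^ 2 / 2) = (Real.exp (-1)) ^ 8 := by
        rw [← Real.exp_nat_mul]; norm_num
      have h6 : Real.exp (-1) ≤ 1 / 2 := by
        rw [Real.exp_neg, one_div]
        refine inv_anti₀ (by norm_num) ?_
        have := Real.add_one_le_exp (1 : ℝ); linarith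
      rw [h5]
      calc _ ≤ (1 / 2 : ℝ) ^ 8 := by gcongr
        _ ≤ _ := by norm_num
    have h5 : (0 : ℝ) ≤ (gaussianReal 0 1).real {x : ℝ | 4 < |x|} := measureReal_nonneg
    nlinarith
  refine (countIn_half (measurableSet_crossSet ρ ((d : ℝ) / n) (z1, z2)) hn hcross).trans_eq ?_
  congr 1

lemma growth_le_one : growth ≤ 1 := by
  have h1 : Real.exp (-9 / 2) ≤ 1 := Real.exp_le_one_iff.2 (by norm_num)
  have h2 : Real.exp (-2) ≤ 1 := Real.exp_le_one_iff.2 (by norm_num)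
  have h3 := Real.exp_pos (-2)
  unfold growth
  nlinarith

/-! ### The survival probability tends to zero. -/

/-- In `k + 1` steps, `log₂ log₂ n ≤ k`, the chain passes `n / 2` with the probability of an
uninterrupted climb. -/
lemma surv_climb {q : ℝ} (hq : 0 ≤ q) (hρ : ρ < 1) (hn : 1 ≤ growth * √n)
    (hjump : ∀ d ≤ n, growth ^ 2 / 2 * n ≤ (d : ℝ) →
      q ≤ (noiseLaw n).real {ξ | n ≤ 2 * crossCount n ρ d ξ})
    {r : ℝ} (hr : 0 < r) (hr1 : r ≤ 1) (hκ : √ρ / √(1 - ρ) * r ≤ 1) {k : ℕ}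
    (hk : (n : ℝ) ≤ 2 ^ 2 ^ k) :
    surv n ρ (k + 1) 1 ≤ 1 - (r / 4 * Real.exp (-1 / 2)) ^ k * q := by
  have hg := growth_pos
  have hn0 : 0 < n := by
    rcases Nat.eq_zero_or_pos n with rfl | h
    · simp at hn; linarith
    · exact h
  have hn' : (0 : ℝ) < n := by exact_mod_cast hn0
  -- The map `d ↦ growth * √(d n)` has the fixed point `growth ^ 2 * n` and takes the square root of
  -- the ratio of `d` to it. Hence the doubly exponential levels: level `i + 1` is mapped to level
  -- `i`, level `0` is macroscopic, and level `k` is at most `1`.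
  refine surv_le_of_levels (a := fun i => growth ^ 2 * n * (1 / 2) ^ 2 ^ i) (by positivity) hq k
    ?_ ?_ 1 hn0 ?_
  · intro i _ d hdn hd
    have hd0 : (0 : ℝ) < d := lt_of_lt_of_le (by positivity) hd
    refine (crossCount_step hρ (by exact_mod_cast hd0) hdn hn hr hr1 hκ).trans ?_
    refine measureReal_mono fun ξ hξ => ?_
    simp only [Set.mem_ofPred_eq] at hξ ⊢
    refine le_trans ?_ hξ
    have h1 : growth * n * (1 / 2) ^ 2 ^ i ≤ √((d : ℝ) * n) := by
      apply Real.le_sqrt_of_sq_le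
      calc _ = (growth ^ 2 * n * (1 / 2) ^ 2 ^ (i + 1)) * n := by ring
        _ ≤ _ := by gcongr
    calc _ = growth * (growth * n * (1 / 2) ^ 2 ^ i) := by ring
      _ ≤ _ := by gcongr
  · intro d hdn hd
    refine hjump d hdn (le_trans (le_of_eq ?_) hd)
    ring
  · rw [one_div, inv_pow, Nat.cast_one]
    have h1 : (0 : ℝ) < 2 ^ 2 ^ k := by positivity
    rw [← div_eq_mul_inv, div_le_one h1]
    have h2 : growth ^ 2 ≤ 1 := pow_le_one₀ hg.le growth_le_one
    nlinarith

/-- The rate in the bound for the absorption probability. -/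
def mergeRate : ℝ := Real.exp (-9 / 2) / 16 * Real.exp (-1)

lemma mergeRate_pos : 0 < mergeRate := by unfold mergeRate; positivity

lemma ratio_sq_le {l : ℝ} (hl : 0 < l) (hρ0 : 0 < ρ) (hρ : ρ < 1 - 4 * l ^ 3 / Real.log n)
    (hlog : Real.log n = Real.exp l) :
    (√ρ / √(1 - ρ)) ^ 2 ≤ Real.exp l / (4 * l ^ 3) := by
  rw [hlog] at hρ
  have hpos : 0 < 4 * l ^ 3 / Real.exp l := by positivity
  rw [div_pow, Real.sq_sqrt hρ0.le, Real.sq_sqrt (by linarith)]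
  calc ρ / (1 - ρ) ≤ 1 / (4 * l ^ 3 / Real.exp l) := by
        gcongr <;> linarith
    _ = _ := by rw [one_div, inv_div]

lemma mergeProb_le_of_log {l : ℝ} (hl : 10 ≤ l) (hlog : Real.log n = Real.exp l) (hn : 1 ≤ n)
    (hρ0 : 0 < ρ) (hρ : ρ < 1 - 4 * l ^ 3 / Real.log n) :
    mergeProb n ρ ≤ 2 * Real.exp (-(4 * l ^ 2)) + Real.exp (-(mergeRate * Real.exp l)) := by
  have hl0 : 0 < l := by linarith
  have hn' : (0 : ℝ) < n := by exact_mod_cast hn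
  have hE := Real.exp_pos l
  have hκ := ratio_sq_le hl0 hρ0 hρ hlog
  have hρ1 : ρ < 1 := by
    have : 0 < 4 * l ^ 3 / Real.log n := by rw [hlog]; positivity
    linarith
  -- With this `R` the Gaussian tail is at most `2 exp(-4l²)`, which beats the `exp(3l²)` steps to
  -- be covered.
  refine (mergeProb_le hρ1 hn (R := 3 * l) (by linarith)).trans ?_
  set κ := √ρ / √(1 - ρ) with hκdef
  have hsqrt : √(n : ℝ) = Real.exp (Real.exp l / 2) := by
    rw [Real.sqrt_eq_rpow, Real.rpow_def_of_pos hn', hlog]; congr 1; ring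
  have h1 : -(3 * l) ^ 2 / 2 ≤ -(4 * l ^ 2) := by nlinarith
  have h2 : (κ * (3 * l) + 1) ^ 2 ≤ 2 * (κ ^ 2 * (9 * l ^ 2)) + 2 := by
    nlinarith [sq_nonneg (κ * (3 * l) - 1)]
  -- The third power of `log log n` in the bound on `ρ` is used here: `κ²` carries `l³` in the
  -- denominator against `R² = 9l²`, so the loss stays below the gain `√n = exp(exp l / 2)`.
  have h3 : κ ^ 2 * (9 * l ^ 2) ≤ Real.exp l / 4 := by
    calc _ ≤ Real.exp l / (4 * l ^ 3) * (9 * l ^ 2) := by gcongr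
      _ = Real.exp l / 4 * (9 / l) := by field_simp
      _ ≤ Real.exp l / 4 * 1 := by
        gcongr
        rw [div_le_one hl0]; linarith
      _ = _ := mul_one _
  have h4 : l ≤ Real.exp l / 4 := by
    have h5 := Real.quadratic_le_exp_of_nonneg hl0.le
    nlinarith
  refine add_le_add (by gcongr) (Real.exp_le_exp.2 (neg_le_neg ?_))
  rw [hsqrt]
  calc mergeRate * Real.exp l
      = Real.exp (-9 / 2) / 16 * Real.exp (-1 + l) := by rw [mergeRate, Real.exp_add]; ring
    _ ≤ Real.exp (-9 / 2) / 16 * Real.exp (-(κ * (3 * l) + 1) ^ 2 / 2 + Real.exp l / 2) := by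
      refine mul_le_mul_of_nonneg_left (Real.exp_le_exp.2 ?_) (by positivity)
      linarith
    _ = _ := by rw [Real.exp_add]; ring

/-- The bound for the probability that the overlap chain has not passed `n / 2`. -/
def survBound (q l : ℝ) : ℝ :=
  Real.exp (-(q * Real.exp (l ^ 2 - 5 * l - 5))) +
    (2 * Real.exp (-l ^ 2) + Real.exp (3 * l ^ 2 - mergeRate * Real.exp l))

lemma surv_le_survBound {q : ℝ} (hq : 0 < q) {l : ℝ} (hl : 10 ≤ l)
    (hlog : Real.log n = Real.exp l) (hn : 1 ≤ n) (hgn : 1 ≤ growth * √n)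
    (hρ0 : 0 < ρ) (hρ : ρ < 1 - 4 * l ^ 3 / Real.log n)
    (hjump : ∀ d ≤ n, growth ^ 2 / 2 * n ≤ (d : ℝ) →
      q ≤ (noiseLaw n).real {ξ | n ≤ 2 * crossCount n ρ d ξ})
    {T : ℕ} (hT : Real.exp (4 * l ^ 2) ≤ T) :
    surv n ρ (T - 1) 1 ≤ survBound q l := by
  have hl0 : 0 < l := by linarith
  have hn' : (0 : ℝ) < n := by exact_mod_cast hn
  have hE := Real.exp_pos l
  have hρ1 : ρ < 1 := by
    have : 0 < 4 * l ^ 3 / Real.log n := by rw [hlog]; positivity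
    linarith
  have hκ2 := ratio_sq_le hl0 hρ0 hρ hlog
  -- This fixes the window `r = exp(-l/2)` for the common Gaussian in each step of a climb.
  have hκ : √ρ / √(1 - ρ) * Real.exp (-l / 2) ≤ 1 := by
    have h1 : √ρ / √(1 - ρ) ≤ Real.exp (l / 2) := by
      refine le_of_sq_le_sq ?_ (Real.exp_pos _).le
      refine hκ2.trans ?_
      rw [← Real.exp_nat_mul, show ((2 : ℕ) : ℝ) * (l / 2) = l by push_cast; ring]
      refine div_le_self hE.le ?_
      nlinarith [pow_le_pow_left₀ (by norm_num) hl 3]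
    calc _ ≤ Real.exp (l / 2) * Real.exp (-l / 2) := by gcongr
      _ = 1 := by rw [← Real.exp_add]; simp; ring
  -- The climb needs `2 ^ k * log 2 ≥ exp l`; since `2 log 2 > 1`, `2l` steps are enough. The
  -- success probability per step is at least `exp(-(l/2 + 2))`, whose `k`-th power is the bound
  -- `hp`.
  set k := ⌈2 * l⌉₊ with hkdef
  have hk1 : 2 * l ≤ k := Nat.le_ceil _
  have hk2 : (k : ℝ) ≤ 2 * l + 1 := (Nat.ceil_lt_add_one (by linarith)).le
  have hk : (n : ℝ) ≤ 2 ^ 2 ^ k := by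
    have h2 := Real.log_two_gt_d9
    have h1 : Real.exp l ≤ 2 ^ k * Real.log 2 := by
      have h3 : (2 : ℝ) ^ k = Real.exp (k * Real.log 2) := by
        rw [Real.exp_nat_mul, Real.exp_log (by norm_num)]
      rw [h3]
      have h4 : Real.exp (l + 1) ≤ Real.exp (k * Real.log 2) := by
        apply Real.exp_le_exp.2
        nlinarith
      rw [Real.exp_add] at h4
      have h5 := Real.add_one_le_exp (1 : ℝ)
      have h6 : 2 * Real.exp l ≤ Real.exp (k * Real.log 2) := by nlinarith
      nlinarith
    rw [← Real.log_le_log_iff hn' (by positivity), hlog, Real.log_pow]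
    exact_mod_cast h1
  have hclimb := surv_climb hq.le hρ1 hgn hjump (Real.exp_pos (-l / 2))
    (Real.exp_le_one_iff.2 (by linarith)) hκ hk
  have hp : Real.exp (-(l ^ 2 + 5 * l + 5)) ≤ (Real.exp (-l / 2) / 4 * Real.exp (-1 / 2)) ^ k := by
    have h4 : (4 : ℝ) ≤ Real.exp (3 / 2) := by
      have h5 : Real.exp (3 / 2) = Real.exp (1 / 2) ^ 3 := by
        rw [← Real.exp_nat_mul]; norm_num
      have h6 := Real.quadratic_le_exp_of_nonneg (show (0 : ℝ) ≤ 1 / 2 by norm_num)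
      rw [h5]
      calc (4 : ℝ) ≤ (1 + 1 / 2 + (1 / 2) ^ 2 / 2) ^ 3 := by norm_num
        _ ≤ _ := by gcongr
    have h7 : Real.exp (-(l / 2 + 2)) ≤ Real.exp (-l / 2) / 4 * Real.exp (-1 / 2) := by
      have h8 : Real.exp (-(l / 2 + 2)) = Real.exp (-l / 2) * Real.exp (-1 / 2)
          * (Real.exp (3 / 2))⁻¹ := by
        rw [← Real.exp_neg, ← Real.exp_add, ← Real.exp_add]; congr 1; ring
      have h9 : (Real.exp (3 / 2))⁻¹ ≤ 4⁻¹ := inv_anti₀ (by norm_num) h4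
      rw [h8]
      calc _ ≤ Real.exp (-l / 2) * Real.exp (-1 / 2) * 4⁻¹ := by gcongr
        _ = _ := by ring
    calc _ ≤ Real.exp (-(l / 2 + 2)) ^ k := by
          rw [← Real.exp_nat_mul]
          apply Real.exp_le_exp.2
          nlinarith
      _ ≤ _ := by gcongr
  -- The number of attempts: it exceeds the inverse success probability, of order `exp(l² + 5l)`, by
  -- a diverging factor, while `m (k + 1)` steps stay below `exp(3l²)`.
  set m := ⌈Real.exp (2 * l ^ 2)⌉₊ with hmdef
  have hm1 : Real.exp (2 * l ^ 2) ≤ m := Nat.le_ceil _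
  have hm2 : (m : ℝ) ≤ 2 * Real.exp (2 * l ^ 2) := by
    have h1 : (m : ℝ) ≤ Real.exp (2 * l ^ 2) + 1 := (Nat.ceil_lt_add_one (Real.exp_pos _).le).le
    have h2 : 1 ≤ Real.exp (2 * l ^ 2) := Real.one_le_exp (by positivity)
    linarith
  have hquad : l ^ 2 + 1 ≤ Real.exp (l ^ 2) := Real.add_one_le_exp _
  have htime : (m : ℝ) * ((k + 1 : ℕ) : ℝ) ≤ Real.exp (3 * l ^ 2) := by
    have hk3 : ((k + 1 : ℕ) : ℝ) ≤ 2 * l + 2 := by push_cast; linarith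
    calc (m : ℝ) * ((k + 1 : ℕ) : ℝ) ≤ 2 * Real.exp (2 * l ^ 2) * (2 * l + 2) := by
          gcongr
      _ = Real.exp (2 * l ^ 2) * (4 * l + 4) := by ring
      _ ≤ Real.exp (2 * l ^ 2) * Real.exp (l ^ 2) := by
          gcongr
          nlinarith
      _ = _ := by rw [← Real.exp_add]; congr 1; ring
  -- One layer is kept in reserve: under a sharp threshold the last layer produces the output and is
  -- not part of the chain.
  have hTm : m * (k + 1) ≤ T - 1 := by
    have h1 : Real.exp (3 * l ^ 2) + 1 ≤ Real.exp (4 * l ^ 2) := by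
      have h2 : Real.exp (4 * l ^ 2) = Real.exp (3 * l ^ 2) * Real.exp (l ^ 2) := by
        rw [← Real.exp_add]; congr 1; ring
      have h3 : 1 ≤ Real.exp (3 * l ^ 2) := Real.one_le_exp (by positivity)
      nlinarith
    have h4 : ((m * (k + 1) + 1 : ℕ) : ℝ) ≤ T := by push_cast at htime ⊢; linarith
    have h5 : m * (k + 1) + 1 ≤ T := by exact_mod_cast h4
    omega
  refine (surv_antitone_time 1 hTm).trans ((surv_mul_le (k + 1) m).trans ?_)
  unfold survBound
  gcongr ?_ + ?_
  · calc surv n ρ (k + 1) 1 ^ m ≤ (Real.exp (-(q * Real.exp (-(l ^ 2 + 5 * l + 5))))) ^ m := by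
          have h0 := surv_nonneg (n := n) (ρ := ρ) (k + 1) 1
          have h1 := Real.add_one_le_exp (-(q * Real.exp (-(l ^ 2 + 5 * l + 5))))
          gcongr
          nlinarith
      _ = Real.exp (-(m * (q * Real.exp (-(l ^ 2 + 5 * l + 5))))) := by
          rw [← Real.exp_nat_mul]; congr 1; ring
      _ ≤ _ := by
          refine Real.exp_le_exp.2 (neg_le_neg ?_)
          calc q * Real.exp (l ^ 2 - 5 * l - 5)
              = Real.exp (2 * l ^ 2) * (q * Real.exp (-(l ^ 2 + 5 * l + 5))) := by
                rw [mul_left_comm, ← Real.exp_add]; congr 2; ring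
            _ ≤ _ := by gcongr
  · have hb := mergeProb_le_of_log hl hlog hn hρ0 hρ
    calc (m : ℝ) * ((k + 1 : ℕ) : ℝ) * mergeProb n ρ
        ≤ Real.exp (3 * l ^ 2) *
          (2 * Real.exp (-(4 * l ^ 2)) + Real.exp (-(mergeRate * Real.exp l))) := by
          have := mergeProb_nonneg (n := n) (ρ := ρ)
          gcongr
      _ = _ := by
          rw [mul_add, mul_left_comm, ← Real.exp_add, ← Real.exp_add]
          congr 3; ring_nf

lemma tendsto_survBound {q : ℝ} (hq : 0 < q) : Tendsto (survBound q) atTop (𝓝 0) := by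
  have h1 : Tendsto (fun l : ℝ => l ^ 2 - 5 * l - 5) atTop atTop := by
    refine tendsto_atTop_mono' atTop ?_ tendsto_id
    filter_upwards [eventually_ge_atTop 10] with l hl
    simp only [id]; nlinarith
  have h2 : Tendsto (fun l : ℝ => mergeRate * Real.exp l - 3 * l ^ 2) atTop atTop := by
    have h3 := Real.tendsto_exp_div_pow_atTop 2
    have h4 := h3.eventually_ge_atTop (4 / mergeRate)
    refine tendsto_atTop_mono' atTop ?_ (tendsto_pow_atTop (α := ℝ) (n := 2) (by norm_num))
    filter_upwards [h4, eventually_gt_atTop 0] with l hl hl0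
    have hm := mergeRate_pos
    rw [div_le_div_iff₀ hm (by positivity)] at hl
    nlinarith
  have h5 : Tendsto (fun l : ℝ => Real.exp (-(q * Real.exp (l ^ 2 - 5 * l - 5)))) atTop (𝓝 0) :=
    Real.tendsto_exp_neg_atTop_nhds_zero.comp
      ((Real.tendsto_exp_atTop.comp h1).const_mul_atTop hq)
  have h6 : Tendsto (fun l : ℝ => Real.exp (-l ^ 2)) atTop (𝓝 0) :=
    Real.tendsto_exp_neg_atTop_nhds_zero.comp
      (tendsto_pow_atTop (α := ℝ) (n := 2) (by norm_num))
  have h7 : Tendsto (fun l : ℝ => Real.exp (3 * l ^ 2 - mergeRate * Real.exp l)) atTop (𝓝 0) := by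
    refine (Real.tendsto_exp_neg_atTop_nhds_zero.comp h2).congr fun l => ?_
    simp only [Function.comp]; congr 1; ring
  have h8 := h5.add ((h6.const_mul 2).add h7)
  have h9 : survBound q = fun l => Real.exp (-(q * Real.exp (l ^ 2 - 5 * l - 5))) +
      (2 * Real.exp (-l ^ 2) + Real.exp (3 * l ^ 2 - mergeRate * Real.exp l)) := rfl
  rw [h9]
  simpa using h8

theorem tendsto_surv {δ : ℝ} {ρ : ℕ → ℝ} {T : ℕ → ℕ} (hδ : 0 < δ)
    (hρ : ∀ᶠ n : ℕ in atTop,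
      δ < ρ n ∧ ρ n < 1 - 4 * Real.log (Real.log n) ^ 3 / Real.log n)
    (hT : ∀ᶠ n : ℕ in atTop, Real.exp (4 * Real.log (Real.log n) ^ 2) ≤ (T n : ℝ)) :
    Tendsto (fun n => surv n (ρ n) (T n - 1) 1) atTop (𝓝 0) := by
  obtain ⟨q, hq, hjump⟩ := crossCount_jump (α := growth ^ 2 / 2) hδ
    (by have := growth_pos; positivity)
  have hlog : Tendsto (fun n : ℕ => Real.log n) atTop atTop :=
    Real.tendsto_log_atTop.comp tendsto_natCast_atTop_atTop
  have hll : Tendsto (fun n : ℕ => Real.log (Real.log n)) atTop atTop :=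
    Real.tendsto_log_atTop.comp hlog
  have hsq : Tendsto (fun n : ℕ => growth * √(n : ℝ)) atTop atTop :=
    (Real.tendsto_sqrt_atTop.comp tendsto_natCast_atTop_atTop).const_mul_atTop growth_pos
  refine squeeze_zero' (Eventually.of_forall fun n => surv_nonneg _ _) ?_
    ((tendsto_survBound hq).comp hll)
  filter_upwards [hρ, hT, hll.eventually_ge_atTop 10, hlog.eventually_gt_atTop 0,
    hsq.eventually_ge_atTop 1, eventually_ge_atTop 1] with n h1 h2 h3 h4 h5 h6
  have hρ1 : ρ n < 1 := by
    have : 0 ≤ 4 * Real.log (Real.log n) ^ 3 / Real.log n := by positivity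
    linarith [h1.2]
  exact surv_le_survBound hq h3 (Real.exp_log h4).symm h6 h5 (hδ.trans h1.1) h1.2
    (fun d hd => hjump n (ρ n) h6 h1.1 hρ1 d hd) h2

/-! ### From the chain to the network: hidden states, mean zero and pair correlations. -/

variable {T : ℕ}

instance : IsProbabilityMeasure (weightLaw n T ρ) := by unfold weightLaw; infer_instance

lemma measurable_layer {α : Type*} [MeasurableSpace α] {W : α → Fin n → Fin n → ℝ}
    {x : α → Cube n} (hW : Measurable W) (hx : Measurable x) :
    Measurable fun a => layer (W a) (x a) := by
  have hc : ∀ j, Measurable fun a => (((x a j : ℤˣ) : ℤ) : ℝ) := fun j =>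
    (measurable_of_countable fun u : ℤˣ => ((u : ℤ) : ℝ)).comp ((measurable_pi_apply j).comp hx)
  refine measurable_pi_lambda _ fun i => measurable_sgn.comp ?_
  refine Finset.measurable_sum _ fun j _ => Measurable.mul ?_ (hc j)
  exact (measurable_pi_apply j).comp ((measurable_pi_apply i).comp hW)

lemma measurable_hiddenState_uncurry (T : ℕ) :
    Measurable fun p : (Fin T → Fin n → Fin n → ℝ) × Cube n => hiddenState T p.1 p.2 := by
  induction T with
  | zero => exact measurable_snd
  | succ T ih =>
    have h1 : Measurable fun p : (Fin (T + 1) → Fin n → Fin n → ℝ) × Cube n =>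
        ((fun t : Fin T => p.1 t.castSucc), p.2) := by fun_prop
    exact measurable_layer ((measurable_pi_apply (Fin.last T)).comp measurable_fst) (ih.comp h1)

lemma measurable_hiddenState (T : ℕ) (x : Cube n) :
    Measurable fun θ : Fin T → Fin n → Fin n → ℝ => hiddenState T θ x :=
  (measurable_hiddenState_uncurry T).comp measurable_prodMk_right

lemma integrable_comp_finite {α β : Type*} [MeasurableSpace α] {μ : Measure α}
    [IsFiniteMeasure μ] [MeasurableSpace β] [Finite β] [MeasurableSingletonClass β] {f : α → β}
    (hf : Measurable f) (F : β → ℝ) : Integrable (fun a => F (f a)) μ := by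
  obtain ⟨C, hC⟩ := (Set.finite_range fun b => |F b|).bddAbove
  exact Integrable.of_bound ((measurable_of_countable F).comp hf).aestronglyMeasurable C
    (ae_of_all _ fun a => hC ⟨f a, rfl⟩)

/-- The mean of `F` over the images of two points under a random layer. -/
def layerOp (n : ℕ) (ρ : ℝ) (F : Cube n → Cube n → ℝ) (x y : Cube n) : ℝ :=
  ∫ W, F (layer W x) (layer W y) ∂layerLaw n ρ

/-- The last layer is independent of the earlier ones and is integrated out first. -/
lemma integral_weightLaw_succ (F : Cube n → Cube n → ℝ) (x y : Cube n) :
    ∫ θ, F (hiddenState (T + 1) θ x) (hiddenState (T + 1) θ y) ∂weightLaw n (T + 1) ρ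
      = ∫ θ, layerOp n ρ F (hiddenState T θ x) (hiddenState T θ y) ∂weightLaw n T ρ := by
  have hmp := measurePreserving_piFinSuccAbove (fun _ : Fin (T + 1) => layerLaw n ρ) (Fin.last T)
  have h1 := hmp.integral_comp' (fun p : (Fin n → Fin n → ℝ) × (Fin T → Fin n → Fin n → ℝ) =>
    F (layer p.1 (hiddenState T p.2 x)) (layer p.1 (hiddenState T p.2 y)))
  have h2 : ∀ θ : Fin (T + 1) → Fin n → Fin n → ℝ,
      F (hiddenState (T + 1) θ x) (hiddenState (T + 1) θ y) =
      (fun p : (Fin n → Fin n → ℝ) × (Fin T → Fin n → Fin n → ℝ) =>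
        F (layer p.1 (hiddenState T p.2 x)) (layer p.1 (hiddenState T p.2 y)))
        (MeasurableEquiv.piFinSuccAbove (fun _ => Fin n → Fin n → ℝ) (Fin.last T) θ) := by
    intro θ
    simp only [MeasurableEquiv.piFinSuccAbove_apply, Fin.insertNthEquiv_symm_apply]
    simp only [hiddenState]
    have h3 : (Fin.last T).removeNth θ = fun t => θ t.castSucc := by
      ext t; simp [Fin.removeNth]
    rw [h3]
  have h4 : weightLaw n (T + 1) ρ = Measure.pi fun _ : Fin (T + 1) => layerLaw n ρ := rfl
  rw [h4]
  simp only [h2]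
  refine h1.trans ?_
  have hm : Measurable fun p : (Fin n → Fin n → ℝ) × (Fin T → Fin n → Fin n → ℝ) =>
      (layer p.1 (hiddenState T p.2 x), layer p.1 (hiddenState T p.2 y)) :=
    (measurable_layer measurable_fst ((measurable_hiddenState T x).comp measurable_snd)).prodMk
      (measurable_layer measurable_fst ((measurable_hiddenState T y).comp measurable_snd))
  exact integral_prod_symm _ (integrable_comp_finite hm fun p : Cube n × Cube n => F p.1 p.2)

lemma integral_hammingDist_hiddenState (hn : 0 < n) (g : ℕ → ℝ) (x y : Cube n) :
    ∫ θ, g (hammingDist (hiddenState T θ x) (hiddenState T θ y)) ∂weightLaw n T ρ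
      = (stepOp n ρ)^[T] g (hammingDist x y) := by
  induction T generalizing g with
  | zero => simp [hiddenState]
  | succ T ih =>
    rw [Function.iterate_succ_apply, ← ih,
      integral_weightLaw_succ fun u v => g (hammingDist u v)]
    simp only [layerOp, integral_hammingDist_layer hn]

lemma integrable_hiddenState (F : Cube n → Cube n → ℝ) (x y : Cube n) :
    Integrable (fun θ => F (hiddenState T θ x) (hiddenState T θ y)) (weightLaw n T ρ) :=
  integrable_comp_finite ((measurable_hiddenState T x).prodMk (measurable_hiddenState T y))
    fun p : Cube n × Cube n => F p.1 p.2

lemma map_neg_layerLaw : (layerLaw n ρ).map (fun W => -W) = layerLaw n ρ := by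
  have hγ : (gaussianReal 0 1).map (fun x => -x) = gaussianReal 0 1 := by
    rw [gaussianReal_map_neg, neg_zero]
  have hpi : (Measure.pi fun _ : Fin n => gaussianReal 0 1).map (fun v i => -v i)
      = Measure.pi fun _ : Fin n => gaussianReal 0 1 := by
    have : SigmaFinite ((gaussianReal 0 1).map fun x => -x) := by rw [hγ]; infer_instance
    rw [Measure.pi_map_pi (f := fun _ x => -x) fun _ => by fun_prop, hγ]
  have hpi2 : (Measure.pi fun _ : Fin n => Measure.pi fun _ : Fin n => gaussianReal 0 1).map
      (fun ψ i j => -ψ i j)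
      = Measure.pi fun _ : Fin n => Measure.pi fun _ : Fin n => gaussianReal 0 1 := by
    have : SigmaFinite ((Measure.pi fun _ : Fin n => gaussianReal 0 1).map fun v i => -v i) := by
      rw [hpi]; infer_instance
    have hm : Measurable fun (v : Fin n → ℝ) j => -v j := by fun_prop
    rw [Measure.pi_map_pi (f := fun _ (v : Fin n → ℝ) j => -v j) fun _ => hm.aemeasurable, hpi]
  have hbase : (baseLaw n).map (Prod.map (fun v i => -v i) fun ψ i j => -ψ i j) = baseLaw n := by
    rw [← Measure.map_prod_map _ _ (by fun_prop) (by fun_prop), hpi, hpi2]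
  rw [layerLaw_eq]
  nth_rw 2 [← hbase]
  rw [Measure.map_map (by fun_prop) (by fun_prop), Measure.map_map (by fun_prop) (by fun_prop)]
  congr 1
  ext p i j
  simp only [Function.comp, combine, Pi.neg_apply, Prod.map_fst, Prod.map_snd]
  ring

/-- The weight law is invariant under `W ↦ -W`, which almost surely flips the whole image. -/
lemma integral_layer_odd (hρ : ρ < 1) {f : Cube n → ℝ} (hf : Function.Odd f) (x : Cube n) :
    ∫ W, f (layer W x) ∂layerLaw n ρ = 0 := by
  have hm : Measurable fun W : Fin n → Fin n → ℝ => f (layer W x) :=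
    (measurable_of_countable f).comp (measurable_layer measurable_id measurable_const)
  have h1 : ∫ W, f (layer W x) ∂layerLaw n ρ = ∫ W, f (layer (-W) x) ∂layerLaw n ρ := by
    conv_lhs => rw [← map_neg_layerLaw, integral_map (by fun_prop) hm.aestronglyMeasurable]
  have h2 : ∫ W, f (layer (-W) x) ∂layerLaw n ρ = -∫ W, f (layer W x) ∂layerLaw n ρ := by
    rw [← integral_neg]
    refine integral_congr_ae ?_
    filter_upwards [ae_dot_row_ne_zero hρ x] with W hW
    rw [neg_layer_of_ne hW, hf]
  linarith

/-- A Boolean function as a real-valued function. -/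
def realOf (h : Cube n → ℤˣ) (x : Cube n) : ℝ := ((h x : ℤ) : ℝ)

lemma realOf_odd {h : Cube n → ℤˣ} (hh : Function.Odd h) : Function.Odd (realOf h) := fun x => by
  simp [realOf, hh x]

lemma abs_units_cast (u : ℤˣ) : |((u : ℤ) : ℝ)| = 1 := by
  rcases Int.units_eq_one_or u with rfl | rfl <;> simp

lemma abs_realOf (h : Cube n → ℤˣ) (x : Cube n) : |realOf h x| = 1 := abs_units_cast _

lemma netReal_eq (h : Cube n → ℤˣ) (θ : Fin T → Fin n → Fin n → ℝ) (x : Cube n) :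
    netReal h θ x = realOf h (hiddenState T θ x) := rfl

lemma integral_netReal (hρ : ρ < 1) {h : Cube n → ℤˣ} (hh : Function.Odd h) (hT : 0 < T)
    (x : Cube n) : ∫ θ, netReal h θ x ∂weightLaw n T ρ = 0 := by
  obtain ⟨T, rfl⟩ : ∃ S, T = S + 1 := ⟨T - 1, by omega⟩
  simp only [netReal_eq]
  rw [integral_weightLaw_succ (fun u _ => realOf h u) x x]
  simp [layerOp, integral_layer_odd hρ (realOf_odd hh)]

/-- The correlation of the outputs at two inputs. -/
def pairCorr (ρ : ℝ) (T : ℕ) (h : Cube n → ℤˣ) (x y : Cube n) : ℝ :=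
  ∫ θ, netReal h θ x * netReal h θ y ∂weightLaw n T ρ

lemma abs_pairCorr_le_one (h : Cube n → ℤˣ) (x y : Cube n) : |pairCorr ρ T h x y| ≤ 1 := by
  have := norm_integral_le_of_norm_le_const (μ := weightLaw n T ρ)
    (f := fun θ => netReal h θ x * netReal h θ y) (C := 1) (ae_of_all _ fun θ => by
      rw [Real.norm_eq_abs, abs_mul, netReal_eq, netReal_eq, abs_realOf, abs_realOf, mul_one])
  simpa [pairCorr] using this

lemma hammingDist_pos_lt {x y : Cube n} (h1 : y ≠ x) (h2 : y ≠ -x) :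
    1 ≤ hammingDist x y ∧ hammingDist x y < n := by
  refine ⟨hammingDist_pos.2 h1.symm, lt_of_le_of_ne (hammingDist_le_card x y) fun h => ?_⟩
  have h3 := hammingDist_neg_right x y
  rw [h, Nat.sub_self, hammingDist_eq_zero] at h3
  exact h2 (by rw [h3, neg_neg])

/-- The correlation of the outputs is small if an odd antitone function of the Hamming distance
approximates the correlation over the last layer. -/
lemma abs_pairCorr_le_of_approx (hρ : ρ < 1) {h : Cube n → ℤˣ} {g : ℕ → ℝ} (hg : Antitone g)
    (hodd : ∀ d ≤ n, g (n - d) = -g d) (hg1 : ∀ d, g d ≤ 1) {ε : ℝ} {S : ℕ}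
    {F : Cube n → Cube n → ℝ}
    (hF : ∀ x y, pairCorr ρ T h x y = ∫ θ, F (hiddenState S θ x) (hiddenState S θ y)
      ∂weightLaw n S ρ)
    {x y : Cube n} (hxy : y ≠ x) (hxy' : y ≠ -x)
    (happ : ∫ θ, |F (hiddenState S θ x) (hiddenState S θ y) -
      g (hammingDist (hiddenState S θ x) (hiddenState S θ y))| ∂weightLaw n S ρ ≤ ε) :
    |pairCorr ρ T h x y| ≤ surv n ρ S 1 + ε := by
  obtain ⟨hd, hdn⟩ := hammingDist_pos_lt hxy hxy'
  have h1 := abs_iterate_stepOp_le (ρ := ρ) hρ hg hodd hg1 S hd hdn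
  rw [← integral_hammingDist_hiddenState (by omega)] at h1
  have h2 : pairCorr ρ T h x y - ∫ θ, g (hammingDist (hiddenState S θ x) (hiddenState S θ y))
      ∂weightLaw n S ρ = ∫ θ, (F (hiddenState S θ x) (hiddenState S θ y) -
      g (hammingDist (hiddenState S θ x) (hiddenState S θ y))) ∂weightLaw n S ρ := by
    rw [hF, integral_sub (integrable_hiddenState F x y)
      (integrable_hiddenState (fun u v => g (hammingDist u v)) x y)]
  have h3 := (abs_integral_le_integral_abs (μ := weightLaw n S ρ) (f := fun θ =>
    F (hiddenState S θ x) (hiddenState S θ y) -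
      g (hammingDist (hiddenState S θ x) (hiddenState S θ y)))).trans happ
  rw [← h2] at h3
  calc |pairCorr ρ T h x y| ≤ |pairCorr ρ T h x y -
        ∫ θ, g (hammingDist (hiddenState S θ x) (hiddenState S θ y)) ∂weightLaw n S ρ| +
        |∫ θ, g (hammingDist (hiddenState S θ x) (hiddenState S θ y)) ∂weightLaw n S ρ| := by
        have := abs_add_le (pairCorr ρ T h x y -
          ∫ θ, g (hammingDist (hiddenState S θ x) (hiddenState S θ y)) ∂weightLaw n S ρ)
          (∫ θ, g (hammingDist (hiddenState S θ x) (hiddenState S θ y)) ∂weightLaw n S ρ)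
        simpa using this
    _ ≤ _ := by linarith

/-! ### Absorption at distance `0` or `n` in very deep networks. -/

/-- The indicator of the distances at which the overlap chain has not been absorbed. -/
def interior (n d : ℕ) : ℝ := if 0 < d ∧ d < n then 1 else 0

lemma interior_le_one (d : ℕ) : interior n d ≤ 1 := by unfold interior; split_ifs <;> simp

lemma interior_reflect {d : ℕ} (hd : d ≤ n) : interior n (n - d) = interior n d := by
  unfold interior
  congr 1
  apply propext
  omega

lemma crossCount_zero (ξ : (ℝ × ℝ) × (Fin n → ℝ × ℝ)) : crossCount n ρ 0 ξ = 0 := by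
  simp [crossCount, Crossing]

/-- The probability of absorption in one step is bounded below, uniformly in the correlation. -/
lemma exists_absorb_prob (n : ℕ) : ∃ κ > 0, ∀ ρ : ℝ, 0 ≤ ρ → ρ < 1 → ∀ d : ℕ, 2 * d ≤ n →
    κ ≤ (noiseLaw n).real {ξ | crossCount n ρ d ξ = 0} := by
  -- If the common and all row Gaussians lie in `B`, then in every row the first combination exceeds
  -- `√ρ + √(1-ρ)` and the second does not. For `d ≤ n/2` the first also has the larger coefficient,
  -- so no row separates. The mass of `B` does not involve `ρ`.
  set B : Set (ℝ × ℝ) := {x : ℝ | |-2 + x| < 1} ×ˢ {x : ℝ | |0 + x| < 1} with hB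
  have hBpos : 0 < gauss2.real B := by
    rw [hB, gauss2_real_prod]
    exact mul_pos
      (lt_of_lt_of_le (by positivity) (gauss_ball_lower (-2) one_pos le_rfl))
      (lt_of_lt_of_le (by positivity) (gauss_ball_lower 0 one_pos le_rfl))
  refine ⟨gauss2.real B * gauss2.real B ^ n, by positivity, fun ρ hρ0 hρ d hd => ?_⟩
  have h1 : (noiseLaw n).real (B ×ˢ Set.univ.pi fun _ => B) = gauss2.real B * gauss2.real B ^ n := by
    rw [measureReal_prod_prod]
    congr 1
    simp [Measure.real, Measure.pi_pi, ENNReal.toReal_pow]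
  rw [← h1]
  refine measureReal_mono ?_
  rintro ⟨⟨z1, z2⟩, w⟩ ⟨⟨hz1, hz2⟩, hw⟩
  have hgt : ∀ x : ℝ, |-2 + x| < 1 → 1 < x := fun x hx => by linarith [(abs_lt.1 hx).1]
  have hz1' : 1 < z1 := hgt _ hz1
  have hz2' : |z2| ≤ 1 := by
    have h : |0 + z2| < 1 := hz2
    rw [zero_add] at h; exact h.le
  change crossCount n ρ d _ = 0
  rw [crossCount, Finset.card_eq_zero, Finset.filter_eq_empty_iff]
  intro i _ hcross
  have hwi := hw i (Set.mem_univ i)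
  have hw1 : 1 < (w i).1 := hgt _ hwi.1
  have hw2 : |(w i).2| ≤ 1 := by
    have h : |0 + (w i).2| < 1 := hwi.2
    rw [zero_add] at h; exact h.le
  have hle := abs_le_of_sgn_add_ne_sgn_sub hcross
  have hn' : (0 : ℝ) < n := by exact_mod_cast i.pos
  have hs : 0 < √(1 - ρ) := Real.sqrt_pos.2 (by linarith)
  have hr := Real.sqrt_nonneg ρ
  have hd2 : (d : ℝ) / n ≤ 1 / 2 := by
    rw [div_le_div_iff₀ hn' two_pos]
    have : ((2 * d : ℕ) : ℝ) ≤ n := by exact_mod_cast hd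
    push_cast at this; linarith
  have h2 : √((d : ℝ) / n) ≤ √(1 - (d : ℝ) / n) := Real.sqrt_le_sqrt (by linarith)
  have h3 : 0 < √(1 - (d : ℝ) / n) := Real.sqrt_pos.2 (by linarith)
  have h4 : √ρ + √(1 - ρ) < √ρ * z1 + √(1 - ρ) * (w i).1 := by nlinarith
  have h5 : |√ρ * z2 + √(1 - ρ) * (w i).2| ≤ √ρ + √(1 - ρ) := by
    calc _ ≤ |√ρ * z2| + |√(1 - ρ) * (w i).2| := abs_add_le _ _
      _ = √ρ * |z2| + √(1 - ρ) * |(w i).2| := by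
        rw [abs_mul, abs_mul, abs_of_nonneg hr, abs_of_pos hs]
      _ ≤ √ρ * 1 + √(1 - ρ) * 1 := by gcongr
      _ = _ := by ring
  rw [abs_mul, abs_mul, abs_of_pos h3, abs_of_nonneg (Real.sqrt_nonneg ((d : ℝ) / n))] at hle
  have h6 : √((d : ℝ) / n) * |√ρ * z2 + √(1 - ρ) * (w i).2|
      ≤ √(1 - (d : ℝ) / n) * (√ρ + √(1 - ρ)) := by gcongr
  have h7 := le_abs_self (√ρ * z1 + √(1 - ρ) * (w i).1)
  have h8 : √(1 - (d : ℝ) / n) * (√ρ + √(1 - ρ)) <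
      √(1 - (d : ℝ) / n) * |√ρ * z1 + √(1 - ρ) * (w i).1| := by
    gcongr
    linarith
  dsimp only at hle
  linarith

/-- Below `n / 2` a mass of at least `κ` goes to `0`; above, reflection sends it to `n`. Both states
are absorbing. -/
lemma stepOp_interior_le (hn : 0 < n) (hρ : ρ < 1) {κ : ℝ}
    (hκ : ∀ d : ℕ, 2 * d ≤ n → κ ≤ (noiseLaw n).real {ξ | crossCount n ρ d ξ = 0})
    {d : ℕ} (hd : d ≤ n) : stepOp n ρ (interior n) d ≤ (1 - κ) * interior n d := by
  have hrefl : ∀ e ≤ n, stepOp n ρ (interior n) (n - e) = stepOp n ρ (interior n) e := by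
    intro e he
    rw [← stepOp_reflect hρ hn _ he]
    exact stepOp_congr (fun f hf => interior_reflect hf) e
  have key : ∀ e, 2 * e ≤ n → stepOp n ρ (interior n) e ≤ (1 - κ) * interior n e := by
    intro e he
    rcases Nat.eq_zero_or_pos e with rfl | he0
    · simp [stepOp, crossCount_zero, interior]
    · have h1 : stepOp n ρ (fun f => interior n f + if f = 0 then 1 else 0) e
          ≤ stepOp n ρ (fun _ => 1) e := by
        refine stepOp_le (fun f _ => ?_) e
        by_cases hf : f = 0
        · simp [hf, interior]
        · simpa [hf] using interior_le_one f
      rw [stepOp_add, stepOp_const, stepOp_indicator (fun f => f = 0)] at h1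
      have h2 : interior n e = 1 := by
        unfold interior; rw [if_pos]; omega
      rw [h2]
      linarith [hκ e he]
  rcases le_total (2 * d) n with h | h
  · exact key d h
  · have := key (n - d) (by omega)
    rwa [hrefl d hd, interior_reflect hd] at this

/-- The absorption probability per step is bounded below in terms of `n` alone, so survival in the
interior decays geometrically and the time can be chosen before `ρ`. -/
lemma exists_absorb_time : ∃ S : ℕ → ℕ, ∀ (n : ℕ) (ρ : ℝ), 0 < n → 0 ≤ ρ → ρ < 1 →
    ∀ T, S n ≤ T → ∀ d ≤ n, (stepOp n ρ)^[T] (interior n) d ≤ 1 / ((n : ℝ) + 1) := by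
  choose κ hκ0 hκ using exists_absorb_prob
  have hκ1 : ∀ n, κ n ≤ 1 := fun n =>
    (hκ n 0 le_rfl one_pos 0 (by simp)).trans measureReal_le_one
  have hS : ∀ n, ∃ S, (1 - κ n) ^ S < 1 / ((n : ℝ) + 1) := fun n =>
    exists_pow_lt_of_lt_one (by positivity) (by linarith [hκ0 n])
  choose S hS using hS
  refine ⟨S, fun n ρ hn hρ0 hρ T hT d hd => ?_⟩
  have h0 : 0 ≤ 1 - κ n := by linarith [hκ1 n]
  have h1 : ∀ t, ∀ d ≤ n, (stepOp n ρ)^[t] (interior n) d ≤ (1 - κ n) ^ t * interior n d := by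
    intro t
    induction t with
    | zero => intro d _; simp
    | succ t ih =>
      intro d hd
      rw [Function.iterate_succ_apply']
      calc _ ≤ stepOp n ρ (fun e => (1 - κ n) ^ t * interior n e) d := stepOp_le ih d
        _ = (1 - κ n) ^ t * stepOp n ρ (interior n) d := stepOp_const_mul _ _ _
        _ ≤ (1 - κ n) ^ t * ((1 - κ n) * interior n d) := by
          gcongr
          exact stepOp_interior_le hn hρ (hκ n ρ hρ0 hρ) hd
        _ = _ := by ring
  calc _ ≤ (1 - κ n) ^ T * interior n d := h1 T d hd
    _ ≤ (1 - κ n) ^ T * 1 := by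
      gcongr
      exact interior_le_one d
    _ = (1 - κ n) ^ T := mul_one _
    _ ≤ (1 - κ n) ^ S n := pow_le_pow_of_le_one h0 (by linarith [hκ0 n]) hT
    _ ≤ _ := (hS n).le

/-- The sign of the absorbing state, zero at the other distances. -/
def absorbSign (n d : ℕ) : ℝ := if d = 0 then 1 else if d < n then 0 else -1

lemma absorbSign_antitone : Antitone (absorbSign n) := by
  intro d e hde
  unfold absorbSign
  split_ifs <;> first | omega | norm_num

lemma absorbSign_odd (hn : 0 < n) : ∀ d ≤ n, absorbSign n (n - d) = -absorbSign n d := by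
  intro d hd
  unfold absorbSign
  split_ifs <;> first | omega | norm_num

lemma absorbSign_le_one (d : ℕ) : absorbSign n d ≤ 1 := by
  unfold absorbSign
  split_ifs <;> norm_num

/-- At equal or opposite points the product of outputs is exactly `1` or `-1`, by oddness of `h`.
Elsewhere `absorbSign` vanishes and the error is one. -/
lemma abs_mul_sub_absorbSign_le (hn : 0 < n) {h : Cube n → ℤˣ} (hh : Function.Odd h)
    (u v : Cube n) :
    |realOf h u * realOf h v - absorbSign n (hammingDist u v)| ≤ interior n (hammingDist u v) := by
  by_cases h1 : v = u
  · subst h1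
    have : realOf h v * realOf h v = 1 := by rw [← abs_mul_abs_self, abs_realOf, one_mul]
    simp [this, absorbSign, interior]
  by_cases h2 : v = -u
  · subst h2
    have : realOf h u * realOf h u = 1 := by rw [← abs_mul_abs_self, abs_realOf, one_mul]
    rw [realOf_odd hh, mul_neg, this, hammingDist_neg_right]
    simp [absorbSign, interior, hn.ne']
  · have h3 := hammingDist_pos_lt h1 h2
    have h4 : absorbSign n (hammingDist u v) = 0 := by
      unfold absorbSign; rw [if_neg (by omega), if_pos h3.2]
    have h5 : interior n (hammingDist u v) = 1 := by
      unfold interior; rw [if_pos]; omega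
    rw [h4, h5, sub_zero, abs_mul, abs_realOf, abs_realOf, one_mul]

lemma abs_pairCorr_le_of_absorb (hρ : ρ < 1) {h : Cube n → ℤˣ} (hh : Function.Odd h) {ε : ℝ}
    (habs : ∀ d ≤ n, (stepOp n ρ)^[T] (interior n) d ≤ ε) {x y : Cube n} (hxy : y ≠ x)
    (hxy' : y ≠ -x) : |pairCorr ρ T h x y| ≤ surv n ρ (T - 1) 1 + ε := by
  have hn : 0 < n := by have := hammingDist_pos_lt hxy hxy'; omega
  have h1 := abs_pairCorr_le_of_approx (T := T) hρ absorbSign_antitone (absorbSign_odd hn)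
    absorbSign_le_one (ε := ε) (S := T) (F := fun u v => realOf h u * realOf h v)
    (fun _ _ => rfl) hxy hxy' ?_
  · refine h1.trans ?_
    gcongr
    exact surv_antitone_time 1 (Nat.sub_le T 1)
  · refine le_trans ?_ (habs _ (hammingDist_le_card x y))
    rw [← integral_hammingDist_hiddenState hn]
    exact integral_mono
      (integrable_hiddenState (fun u v =>
        |realOf h u * realOf h v - absorbSign n (hammingDist u v)|) x y)
      (integrable_hiddenState (fun u v => interior n (hammingDist u v)) x y)
      fun θ => abs_mul_sub_absorbSign_le hn hh _ _

/-! ### Sharp thresholds: the output as the sign of the last common Gaussian. -/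

/-- The law on `{-1, 1}` that gives probability `p` to `1`. -/
def signLaw (p : ℝ) : Measure ℤˣ :=
  ENNReal.ofReal p • Measure.dirac (1 : ℤˣ) + ENNReal.ofReal (1 - p) • Measure.dirac (-1 : ℤˣ)

lemma isProbabilityMeasure_signLaw {p : ℝ} (h0 : 0 ≤ p) (h1 : p ≤ 1) :
    IsProbabilityMeasure (signLaw p) := by
  refine ⟨?_⟩
  simp only [signLaw, Measure.add_apply, Measure.smul_apply, measure_univ, smul_eq_mul, mul_one]
  rw [← ENNReal.ofReal_add h0 (by linarith)]
  simp

lemma isProbabilityMeasure_biasedLaw {p : ℝ} (h0 : 0 ≤ p) (h1 : p ≤ 1) :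
    IsProbabilityMeasure (biasedLaw n p) := by
  have := isProbabilityMeasure_signLaw h0 h1
  exact inferInstanceAs (IsProbabilityMeasure (Measure.pi fun _ : Fin n => signLaw p))

lemma map_eq_signLaw {α : Type*} [MeasurableSpace α] {μ : Measure α} [IsProbabilityMeasure μ]
    {f : α → ℤˣ} (hf : Measurable f) : μ.map f = signLaw (μ.real {a | f a = 1}) := by
  have hm : MeasurableSet {a | f a = 1} := hf (measurableSet_singleton 1)
  have hc : {a | f a = -1} = {a | f a = 1}ᶜ := by
    ext a
    rcases Int.units_eq_one_or (f a) with h | h <;> simp [h]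
  have h1 : (μ.map f) {1} = ENNReal.ofReal (μ.real {a | f a = 1}) := by
    rw [Measure.map_apply hf (measurableSet_singleton _), ofReal_measureReal]
    rfl
  have h2 : (μ.map f) {-1} = ENNReal.ofReal (1 - μ.real {a | f a = 1}) := by
    rw [Measure.map_apply hf (measurableSet_singleton _), ← probReal_compl_eq_one_sub hm,
      ofReal_measureReal, ← hc]
    rfl
  refine Measure.ext_of_singleton fun u => ?_
  rcases Int.units_eq_one_or u with rfl | rfl
  · rw [h1]; simp [signLaw]
  · rw [h2]; simp [signLaw]

/-- The probability that a neuron is `1` when its common Gaussian equals `c`. -/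
def bias (n : ℕ) (ρ c : ℝ) : ℝ :=
  (gaussianReal 0 1).real {g | sgn (√ρ * c + √(1 - ρ) * (√n * g)) = 1}

/-- Given the common vector `ν` the neurons are independent with one bias, which depends on `ν` and
`x` only through `dot ν x`. This brings the image of a layer into the form required by
`HasSharpThreshold`. -/
lemma map_layer_section (ν : Fin n → ℝ) (x : Cube n) :
    (Measure.pi fun _ : Fin n => Measure.pi fun _ : Fin n => gaussianReal 0 1).map
      (fun ψ => layer (combine ρ (ν, ψ)) x) = biasedLaw n (bias n ρ (dot ν x)) := by
  have hf : Measurable fun v : Fin n → ℝ => sgn (√ρ * dot ν x + √(1 - ρ) * dot v x) := by fun_prop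
  have h1 : (Measure.pi fun _ : Fin n => gaussianReal 0 1).map
      (fun v => sgn (√ρ * dot ν x + √(1 - ρ) * dot v x)) = signLaw (bias n ρ (dot ν x)) := by
    have h2 : (fun v : Fin n → ℝ => sgn (√ρ * dot ν x + √(1 - ρ) * dot v x))
        = (fun u => sgn (√ρ * dot ν x + √(1 - ρ) * u)) ∘ fun v => dot v x := rfl
    rw [h2, ← Measure.map_map (by fun_prop) (by fun_prop), map_dot,
      Measure.map_map (by fun_prop) (by fun_prop), map_eq_signLaw (by fun_prop)]
    rfl
  have hp : IsProbabilityMeasure ((Measure.pi fun _ : Fin n => gaussianReal 0 1).map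
      (fun v => sgn (√ρ * dot ν x + √(1 - ρ) * dot v x))) :=
    Measure.isProbabilityMeasure_map hf.aemeasurable
  have h3 : (fun ψ : Fin n → Fin n → ℝ => layer (combine ρ (ν, ψ)) x)
      = fun ψ i => sgn (√ρ * dot ν x + √(1 - ρ) * dot (ψ i) x) := by
    ext1 ψ
    ext1 i
    rw [layer_apply, dot_combine]
  rw [h3, Measure.pi_map_pi (f := fun _ v => sgn (√ρ * dot ν x + √(1 - ρ) * dot v x))
    (fun _ => hf.aemeasurable), h1]
  rfl

lemma sgn_eq_one_iff {x : ℝ} : sgn x = 1 ↔ 0 ≤ x := by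
  constructor
  · intro h
    by_contra! hc
    rw [sgn_of_neg hc] at h
    exact absurd h (by decide)
  · exact sgn_of_nonneg

lemma gauss_Ici (r : ℝ) (hr : 0 < r) : (gaussianReal 0 1).real (Set.Ici r)
    = 1 / 2 - (gaussianReal 0 1).real {x | |0 + x| < r} / 2 ∧
    (gaussianReal 0 1).real (Set.Iic (-r))
    = 1 / 2 - (gaussianReal 0 1).real {x | |0 + x| < r} / 2 := by
  have hγ : (gaussianReal 0 1).map (fun x => -x) = gaussianReal 0 1 := by
    rw [gaussianReal_map_neg, neg_zero]
  have h1 : (gaussianReal 0 1).real (Set.Iic (-r)) = (gaussianReal 0 1).real (Set.Ici r) := by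
    conv_lhs => rw [← hγ]
    rw [Measure.real, Measure.map_apply (by fun_prop) measurableSet_Iic, Measure.real]
    congr 2
    ext x; simp
  have hm : MeasurableSet {x : ℝ | |0 + x| < r} := measurableSet_lt (by fun_prop) measurable_const
  have h2 : {x : ℝ | |0 + x| < r}ᶜ = Set.Iic (-r) ∪ Set.Ici r := by
    ext x
    simp only [zero_add, Set.mem_compl_iff, Set.mem_ofPred_eq, not_lt, Set.mem_union, Set.mem_Iic,
      Set.mem_Ici, le_abs]
    constructor
    · rintro (h | h)
      · exact Or.inr h
      · exact Or.inl (by linarith)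
    · rintro (h | h)
      · exact Or.inr (by linarith)
      · exact Or.inl h
  have h3 := probReal_compl_eq_one_sub (μ := gaussianReal 0 1) hm
  rw [h2, measureReal_union _ measurableSet_Ici, h1] at h3
  · constructor <;> linarith
  · rw [Set.disjoint_left]
    intro x hx hx'
    simp only [Set.mem_Iic, Set.mem_Ici] at hx hx'
    linarith

/-- A common Gaussian away from `0` biases the neurons in its direction. -/
lemma bias_gap {δ r c : ℝ} (hr : 0 < r) (hδ : 0 < δ) (hδρ : δ < ρ) (hρ : ρ < 1) (hn : 0 < n)
    (hc : r * √n ≤ |c|) :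
    sgn (bias n ρ c - 1 / 2) = sgn c ∧
      (gaussianReal 0 1).real {x | |0 + x| < √δ * r} / 2 ≤ |bias n ρ c - 1 / 2| := by
  have hn' : 0 < √(n : ℝ) := Real.sqrt_pos.2 (by exact_mod_cast hn)
  have hs : 0 < √(1 - ρ) := Real.sqrt_pos.2 (by linarith)
  have hs1 : √(1 - ρ) ≤ 1 := Real.sqrt_le_one.2 (by linarith)
  have hδ0 := Real.sqrt_pos.2 hδ
  have hrδ : √δ ≤ √ρ := Real.sqrt_le_sqrt hδρ.le
  have hR : 0 < √δ * r := by positivity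
  obtain ⟨h1, h2⟩ := gauss_Ici (√δ * r) hR
  have hgap : 0 < (gaussianReal 0 1).real {x | |0 + x| < √δ * r} := by
    have h3 : 0 < min (√δ * r) 1 := lt_min hR one_pos
    refine lt_of_lt_of_le (by positivity) ((gauss_ball_lower 0 h3 (min_le_right _ _)).trans
      (measureReal_mono fun x hx => ?_))
    exact lt_of_lt_of_le (show |0 + x| < min (√δ * r) 1 from hx) (min_le_left _ _)
  rcases le_total 0 c with hc0 | hc0
  · rw [abs_of_nonneg hc0] at hc
    -- The common part is at least `√δ * r * √n`, and a row Gaussian above `-(√δ * r)`, scaled by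
    -- `√(1-ρ) * √n`, cannot outweigh it because `√(1-ρ) ≤ 1`.
    have h3 : 1 - (gaussianReal 0 1).real (Set.Iic (-(√δ * r))) ≤ bias n ρ c := by
      rw [← probReal_compl_eq_one_sub measurableSet_Iic]
      refine measureReal_mono fun g hg => ?_
      have hg' : -(√δ * r) < g := not_le.1 hg
      refine sgn_eq_one_iff.2 ?_
      have h4 : √δ * (r * √n) ≤ √ρ * c := by gcongr
      have h5 : √(1 - ρ) * (√n * (-(√δ * r))) ≤ √(1 - ρ) * (√n * g) := by gcongr
      have h6 : √(1 - ρ) * (√n * (√δ * r)) ≤ 1 * (√n * (√δ * r)) := by gcongr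
      nlinarith
    rw [h2] at h3
    have h7 : (gaussianReal 0 1).real {x | |0 + x| < √δ * r} / 2 ≤ bias n ρ c - 1 / 2 := by
      linarith
    exact ⟨by rw [sgn_of_nonneg hc0, sgn_of_nonneg (by linarith)], h7.trans (le_abs_self _)⟩
  · rw [abs_of_nonpos hc0] at hc
    have hcneg : c < 0 := by
      have : 0 < r * √n := by positivity
      linarith
    have h3 : bias n ρ c ≤ (gaussianReal 0 1).real (Set.Ici (√δ * r)) := by
      refine measureReal_mono fun g hg => ?_
      have hg' : 0 ≤ √ρ * c + √(1 - ρ) * (√n * g) := sgn_eq_one_iff.1 hg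
      have h4 : √δ * (r * √n) ≤ √ρ * (-c) := by gcongr
      have h5 : √n * (√δ * r) ≤ √n * (√(1 - ρ) * g) := by nlinarith
      have h6 : √δ * r ≤ √(1 - ρ) * g := le_of_mul_le_mul_left h5 hn'
      have h7 : 0 ≤ g := by
        by_contra! h
        have := mul_neg_of_pos_of_neg hs h
        linarith
      have h8 : √(1 - ρ) * g ≤ g := mul_le_of_le_one_left h7 hs1
      exact h6.trans h8
    rw [h1] at h3
    have h7 : (gaussianReal 0 1).real {x | |0 + x| < √δ * r} / 2 ≤ -(bias n ρ c - 1 / 2) := by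
      linarith
    exact ⟨by rw [sgn_of_neg hcneg, sgn_of_neg (by linarith)], h7.trans (neg_le_abs _)⟩

/-- A sharp threshold is uniform in the bias. -/
lemma HasSharpThreshold.uniform {h : ∀ n : ℕ, Cube n → ℤˣ} (hh : HasSharpThreshold h) {γ ε : ℝ}
    (hγ : 0 < γ) (hε : 0 < ε) :
    ∀ᶠ n : ℕ in atTop, ∀ p : ℝ, 0 ≤ p → p ≤ 1 → γ ≤ |p - 1 / 2| →
      (biasedLaw n p).real {x | h n x ≠ sgn (p - 1 / 2)} ≤ ε := by
  classical
  by_cases hγ2 : 1 / 2 < γ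
  · refine Eventually.of_forall fun n p h0 h1 hp => ?_
    have : |p - 1 / 2| ≤ 1 / 2 := abs_le.2 ⟨by linarith, by linarith⟩
    linarith
  push Not at hγ2
  let bad : ℕ → ℝ → Prop := fun n p => (0 ≤ p ∧ p ≤ 1) ∧ γ ≤ |p - 1 / 2| ∧
    ε < (biasedLaw n p).real {x | h n x ≠ sgn (p - 1 / 2)}
  -- A sequence that picks a bad bias whenever one exists; the threshold property along this single
  -- sequence gives uniformity. The default `1` is admissible because `γ ≤ 1/2`.
  let p : ℕ → ℝ := fun n => if hb : ∃ q, bad n q then hb.choose else 1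
  have hp : ∀ n, (0 ≤ p n ∧ p n ≤ 1) ∧ γ ≤ |p n - 1 / 2| := by
    intro n
    by_cases hb : ∃ q, bad n q
    · have h1 : p n = hb.choose := dif_pos hb
      rw [h1]
      exact ⟨hb.choose_spec.1, hb.choose_spec.2.1⟩
    · have h1 : p n = 1 := dif_neg hb
      rw [h1]
      norm_num
      linarith
  have hlim := hh p (fun n => (hp n).1) ⟨γ, hγ, fun n => (hp n).2⟩
  filter_upwards [hlim.eventually (lt_mem_nhds (show 1 - ε < 1 by linarith))] with n hn q h0 h1 hq
  by_contra! hbad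
  have hb : ∃ q, bad n q := ⟨q, ⟨h0, h1⟩, hq, hbad⟩
  have h2 : p n = hb.choose := dif_pos hb
  have h3 := hb.choose_spec.2.2
  rw [← h2] at h3
  have := isProbabilityMeasure_biasedLaw (n := n) (hp n).1.1 (hp n).1.2
  have hm : MeasurableSet {x : Cube n | h n x = sgn (p n - 1 / 2)} := Set.Finite.measurableSet
    (Set.toFinite _)
  have h4 := probReal_compl_eq_one_sub (μ := biasedLaw n (p n)) hm
  have h5 : {x : Cube n | h n x = sgn (p n - 1 / 2)}ᶜ = {x | h n x ≠ sgn (p n - 1 / 2)} := rfl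
  rw [h5] at h4
  linarith

/-- Under a sharp threshold the output is the sign of the common Gaussian of the last layer. -/
lemma HasSharpThreshold.layer_ne_le {h : ∀ n : ℕ, Cube n → ℤˣ} (hh : HasSharpThreshold h)
    {δ ε : ℝ} (hδ : 0 < δ) (hε : 0 < ε) :
    ∀ᶠ n : ℕ in atTop, ∀ ρ : ℝ, δ < ρ → ρ < 1 → ∀ x : Cube n,
      (baseLaw n).real {p | h n (layer (combine ρ p) x) ≠ sgn (dot p.1 x)} ≤ ε := by
  -- The event `|dot ν x| < r √n` has probability at most `2r = ε/2`; the other half of `ε` is for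
  -- the threshold.
  set r : ℝ := ε / 4 with hr
  have hr0 : 0 < r := by positivity
  have hgap : 0 < (gaussianReal 0 1).real {x | |0 + x| < √δ * r} / 2 := by
    have hδ0 := Real.sqrt_pos.2 hδ
    have h3 : 0 < min (√δ * r) 1 := lt_min (by positivity) one_pos
    refine half_pos (lt_of_lt_of_le (by positivity)
      ((gauss_ball_lower 0 h3 (min_le_right _ _)).trans (measureReal_mono fun x hx => ?_)))
    exact lt_of_lt_of_le (show |0 + x| < min (√δ * r) 1 from hx) (min_le_left _ _)
  filter_upwards [hh.uniform hgap (half_pos hε), eventually_gt_atTop 0] with n hn hn0 ρ hδρ hρ x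
  have hn' : 0 < √(n : ℝ) := Real.sqrt_pos.2 (by exact_mod_cast hn0)
  have hlay : Measurable fun p : (Fin n → ℝ) × (Fin n → Fin n → ℝ) => layer (combine ρ p) x :=
    measurable_layer measurable_combine measurable_const
  have hS : MeasurableSet {p : (Fin n → ℝ) × (Fin n → Fin n → ℝ) |
      h n (layer (combine ρ p) x) ≠ sgn (dot p.1 x)} :=
    (measurableSet_eq_fun ((measurable_of_countable (h n)).comp hlay) (by fun_prop)).compl
  have hA : MeasurableSet {ν : Fin n → ℝ | r * √n ≤ |dot ν x|} :=
    measurableSet_le measurable_const (by fun_prop)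
  have h1 := prod_real_le_add (μ := Measure.pi fun _ : Fin n => gaussianReal 0 1)
    (ν := Measure.pi fun _ : Fin n => Measure.pi fun _ : Fin n => gaussianReal 0 1) hS hA
    (half_pos hε).le fun ν hν => by
      have hν' : r * √n ≤ |dot ν x| := hν
      obtain ⟨h2, h3⟩ := bias_gap hr0 hδ hδρ hρ hn0 hν'
      have h4 := hn (bias n ρ (dot ν x)) measureReal_nonneg measureReal_le_one h3
      have hsec : Measurable fun ψ => layer (combine ρ (ν, ψ)) x :=
        hlay.comp measurable_prodMk_left
      rw [h2, ← map_layer_section, Measure.real,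
        Measure.map_apply hsec (Set.Finite.measurableSet (Set.toFinite _))] at h4
      exact h4
  refine h1.trans ?_
  have h5 : (Measure.pi fun _ : Fin n => gaussianReal 0 1).real {ν | r * √n ≤ |dot ν x|}ᶜ
      ≤ 2 * r := by
    refine le_trans (le_of_eq ?_) (gauss_ball_upper hr0.le)
    have h6 : {ν : Fin n → ℝ | r * √n ≤ |dot ν x|}ᶜ
        = (fun ν => dot ν x) ⁻¹' {u | |u| < r * √n} := by
      ext ν; simp
    have hm : MeasurableSet {u : ℝ | |u| < r * √n} := measurableSet_lt (by fun_prop) measurable_const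
    rw [h6, Measure.real, ← Measure.map_apply (measurable_dot x) hm, map_dot,
      Measure.map_apply (by fun_prop) hm, Measure.real]
    congr 2
    ext g
    simp only [Set.mem_preimage, Set.mem_ofPred_eq, abs_mul, abs_of_pos hn']
    rw [mul_comm, mul_lt_mul_iff_left₀ hn']
  linarith

/-- The correlation of the signs of the common Gaussians of two inputs at distance `d`. -/
def signCorr (n d : ℕ) : ℝ :=
  ∫ z, (if Crossing ((d : ℝ) / n) z.1 z.2 then -1 else 1) ∂gauss2

lemma measurableSet_crossing (a : ℝ) : MeasurableSet {z : ℝ × ℝ | Crossing a z.1 z.2} :=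
  (measurableSet_eq_fun (f := fun z : ℝ × ℝ => sgn _) (by fun_prop) (by fun_prop)).compl

lemma integrable_crossing (a : ℝ) :
    Integrable (fun z : ℝ × ℝ => if Crossing a z.1 z.2 then (-1 : ℝ) else 1) gauss2 := by
  refine Integrable.of_bound (Measurable.ite (measurableSet_crossing a) measurable_const
    measurable_const).aestronglyMeasurable 1 (ae_of_all _ fun z => ?_)
  split_ifs <;> simp

/-- The coupling by `Crossing.mono`, now for the common Gaussian alone. Together with `signCorr_odd`
it makes `signCorr` an admissible test function for the chain. -/
lemma signCorr_antitone : Antitone (signCorr n) := by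
  intro d e hde
  refine integral_mono (integrable_crossing _) (integrable_crossing _) fun z => ?_
  have h : Crossing ((d : ℝ) / n) z.1 z.2 → Crossing ((e : ℝ) / n) z.1 z.2 :=
    Crossing.mono (by positivity) (by gcongr)
  dsimp only
  split_ifs with h1 h2 h2
  · exact le_rfl
  · norm_num
  · exact absurd (h h2) h1
  · exact le_rfl

lemma signCorr_le_one (d : ℕ) : signCorr n d ≤ 1 := by
  have h : signCorr n d ≤ ∫ _, (1 : ℝ) ∂gauss2 :=
    integral_mono (integrable_crossing _) (integrable_const 1) fun z => by
      dsimp only; split_ifs <;> norm_num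
  simpa using h

/-- The sign of the inner product, as a real number. -/
def dotSign (v : Fin n → ℝ) (x : Cube n) : ℝ := ((sgn (dot v x) : ℤ) : ℝ)

@[fun_prop]
lemma measurable_dotSign (x : Cube n) : Measurable fun v : Fin n → ℝ => dotSign v x :=
  (measurable_of_countable fun u : ℤˣ => ((u : ℤ) : ℝ)).comp (by fun_prop)

lemma abs_dotSign (v : Fin n → ℝ) (x : Cube n) : |dotSign v x| = 1 := abs_units_cast _

lemma integral_dotSign_mul (hn : 0 < n) (x y : Cube n) :
    ∫ v, dotSign v x * dotSign v y ∂(Measure.pi fun _ : Fin n => gaussianReal 0 1)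
      = signCorr n (hammingDist x y) := by
  have hu : ∀ u v : ℤˣ, ((u : ℤ) : ℝ) * ((v : ℤ) : ℝ) = if u ≠ v then -1 else 1 := by
    intro u v
    rcases Int.units_eq_one_or u with rfl | rfl <;> rcases Int.units_eq_one_or v with rfl | rfl <;>
      norm_num
  have hm : Measurable fun p : ℝ × ℝ => if sgn p.1 ≠ sgn p.2 then (-1 : ℝ) else 1 :=
    Measurable.ite (measurableSet_eq_fun (by fun_prop) (by fun_prop)).compl measurable_const
      measurable_const
  have h1 := integral_map (μ := Measure.pi fun _ : Fin n => gaussianReal 0 1)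
    (φ := fun v => (dot v x, dot v y)) (by fun_prop) hm.aestronglyMeasurable
  have h2 : (fun z : ℝ × ℝ =>
        (√(n - (hammingDist x y : ℝ)) * z.1 + √(hammingDist x y : ℝ) * z.2,
          √(n - (hammingDist x y : ℝ)) * z.1 - √(hammingDist x y : ℝ) * z.2))
      = spread n (hammingDist x y) := rfl
  rw [map_dot_pair, h2, integral_map (by fun_prop) hm.aestronglyMeasurable] at h1
  simp only [dotSign, hu]
  refine h1.symm.trans (integral_congr_ae (ae_of_all _ fun z => ?_))
  -- Taking `ρ = 1` and zero row noise leaves only the common Gaussian.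
  have h3 := sgn_spread_ne_iff (ρ := 1) (d := hammingDist x y) hn z 0
  simp only [Real.sqrt_one, one_mul, sub_self, Real.sqrt_zero, zero_mul, add_zero] at h3
  simp only [h3]

lemma signCorr_odd (hn : 0 < n) : ∀ d ≤ n, signCorr n (n - d) = -signCorr n d := by
  intro d hd
  obtain ⟨x, y, rfl⟩ := exists_hammingDist_eq hd
  rw [← hammingDist_neg_right, ← integral_dotSign_mul hn, ← integral_dotSign_mul hn,
    ← integral_neg]
  refine integral_congr_ae ?_
  filter_upwards [ae_dot_ne hn y 0] with v hv
  simp [dotSign, dot_neg, sgn_neg hv]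

lemma abs_units_sub_le (u v : ℤˣ) :
    |((u : ℤ) : ℝ) - ((v : ℤ) : ℝ)| ≤ 2 * if u ≠ v then 1 else 0 := by
  rcases Int.units_eq_one_or u with rfl | rfl <;> rcases Int.units_eq_one_or v with rfl | rfl <;>
    norm_num

/-- Both outputs are replaced by the signs of the common Gaussian, one after the other; each
replacement changes a factor by at most `2` on an event of probability at most `ε`. -/
lemma abs_layerOp_sub_signCorr_le (hn : 0 < n) {h : Cube n → ℤˣ} {ε : ℝ}
    (hε : ∀ x : Cube n,
      (baseLaw n).real {p | h (layer (combine ρ p) x) ≠ sgn (dot p.1 x)} ≤ ε) (x y : Cube n) :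
    |layerOp n ρ (fun u v => realOf h u * realOf h v) x y - signCorr n (hammingDist x y)|
      ≤ 4 * ε := by
  have hlay : ∀ x : Cube n, Measurable fun p : (Fin n → ℝ) × (Fin n → Fin n → ℝ) =>
      layer (combine ρ p) x := fun x => measurable_layer measurable_combine measurable_const
  have hreal : ∀ x : Cube n, Measurable fun p : (Fin n → ℝ) × (Fin n → Fin n → ℝ) =>
      realOf h (layer (combine ρ p) x) := fun x =>
    (measurable_of_countable (realOf h)).comp (hlay x)
  have hS : ∀ x : Cube n, MeasurableSet {p : (Fin n → ℝ) × (Fin n → Fin n → ℝ) |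
      h (layer (combine ρ p) x) ≠ sgn (dot p.1 x)} := fun x =>
    (measurableSet_eq_fun ((measurable_of_countable h).comp (hlay x)) (by fun_prop)).compl
  have h1 : layerOp n ρ (fun u v => realOf h u * realOf h v) x y
      = ∫ p, realOf h (layer (combine ρ p) x) * realOf h (layer (combine ρ p) y) ∂baseLaw n := by
    rw [layerOp, layerLaw_eq, integral_map measurable_combine.aemeasurable]
    have hW : ∀ x : Cube n, Measurable fun W : Fin n → Fin n → ℝ => realOf h (layer W x) := fun x =>
      (measurable_of_countable (realOf h)).comp (measurable_layer measurable_id measurable_const)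
    exact ((hW x).mul (hW y)).aestronglyMeasurable
  have h2 : signCorr n (hammingDist x y) = ∫ p, dotSign p.1 x * dotSign p.1 y ∂baseLaw n := by
    rw [← integral_dotSign_mul hn]
    have h3 := (measurePreserving_fst (μ := Measure.pi fun _ : Fin n => gaussianReal 0 1)
      (ν := Measure.pi fun _ : Fin n => Measure.pi fun _ : Fin n => gaussianReal 0 1)).map_eq
    conv_lhs => rw [← h3]
    rw [integral_map measurable_fst.aemeasurable]
    exact (((measurable_dotSign x).mul (measurable_dotSign y))).aestronglyMeasurable
  have hi1 : Integrable (fun p => realOf h (layer (combine ρ p) x) * realOf h (layer (combine ρ p) y))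
      (baseLaw n) := by
    refine Integrable.of_bound ((hreal x).mul (hreal y)).aestronglyMeasurable 1
      (ae_of_all _ fun p => ?_)
    rw [Real.norm_eq_abs, abs_mul, abs_realOf, abs_realOf, one_mul]
  have hi2 : Integrable (fun p : (Fin n → ℝ) × (Fin n → Fin n → ℝ) =>
      dotSign p.1 x * dotSign p.1 y) (baseLaw n) := by
    refine Integrable.of_bound (Measurable.aestronglyMeasurable (by fun_prop)) 1
      (ae_of_all _ fun p => ?_)
    rw [Real.norm_eq_abs, abs_mul, abs_dotSign, abs_dotSign, one_mul]
  have hind : ∀ x : Cube n, Integrable (fun p => Set.indicator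
      {p : (Fin n → ℝ) × (Fin n → Fin n → ℝ) | h (layer (combine ρ p) x) ≠ sgn (dot p.1 x)}
      (fun _ => (2 : ℝ)) p) (baseLaw n) := fun x => (integrable_const 2).indicator (hS x)
  rw [h1, h2, ← integral_sub hi1 hi2]
  have hpt : ∀ (x : Cube n) (p : (Fin n → ℝ) × (Fin n → Fin n → ℝ)),
      |realOf h (layer (combine ρ p) x) - dotSign p.1 x| ≤ Set.indicator
      {p : (Fin n → ℝ) × (Fin n → Fin n → ℝ) | h (layer (combine ρ p) x) ≠ sgn (dot p.1 x)}
      (fun _ => (2 : ℝ)) p := by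
    intro x p
    refine (abs_units_sub_le _ _).trans_eq ?_
    by_cases hp : h (layer (combine ρ p) x) ≠ sgn (dot p.1 x) <;> simp [Set.indicator, hp]
  calc _ ≤ ∫ p, |realOf h (layer (combine ρ p) x) * realOf h (layer (combine ρ p) y) -
        dotSign p.1 x * dotSign p.1 y| ∂baseLaw n := abs_integral_le_integral_abs
    _ ≤ ∫ p, (Set.indicator
      {p : (Fin n → ℝ) × (Fin n → Fin n → ℝ) | h (layer (combine ρ p) x) ≠ sgn (dot p.1 x)}
      (fun _ => (2 : ℝ)) p + Set.indicator
      {p : (Fin n → ℝ) × (Fin n → Fin n → ℝ) | h (layer (combine ρ p) y) ≠ sgn (dot p.1 y)}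
      (fun _ => (2 : ℝ)) p) ∂baseLaw n := by
      refine integral_mono (hi1.sub hi2).abs ((hind x).add (hind y)) fun p => ?_
      have h3 : realOf h (layer (combine ρ p) x) * realOf h (layer (combine ρ p) y) -
          dotSign p.1 x * dotSign p.1 y =
          (realOf h (layer (combine ρ p) x) - dotSign p.1 x) * realOf h (layer (combine ρ p) y)
          + dotSign p.1 x * (realOf h (layer (combine ρ p) y) - dotSign p.1 y) := by ring
      dsimp only
      rw [h3]
      refine (abs_add_le _ _).trans ?_
      rw [abs_mul, abs_mul, abs_realOf, abs_dotSign, one_mul, mul_one]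
      exact add_le_add (hpt x p) (hpt y p)
    _ ≤ 4 * ε := by
      rw [integral_add (hind x) (hind y), integral_indicator_const _ (hS x),
        integral_indicator_const _ (hS y), smul_eq_mul, smul_eq_mul]
      linarith [hε x, hε y]

lemma abs_pairCorr_le_of_threshold (hρ : ρ < 1) {h : Cube n → ℤˣ} {ε : ℝ} (hT : 0 < T)
    (hε : ∀ x : Cube n,
      (baseLaw n).real {p | h (layer (combine ρ p) x) ≠ sgn (dot p.1 x)} ≤ ε)
    {x y : Cube n} (hxy : y ≠ x) (hxy' : y ≠ -x) :
    |pairCorr ρ T h x y| ≤ surv n ρ (T - 1) 1 + 4 * ε := by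
  have hn : 0 < n := by have := hammingDist_pos_lt hxy hxy'; omega
  obtain ⟨S, rfl⟩ : ∃ S, T = S + 1 := ⟨T - 1, by omega⟩
  refine abs_pairCorr_le_of_approx (T := S + 1) hρ signCorr_antitone (signCorr_odd hn)
    signCorr_le_one (S := S) (F := layerOp n ρ fun u v => realOf h u * realOf h v)
    (fun x y => integral_weightLaw_succ (fun u v => realOf h u * realOf h v) x y) hxy hxy' ?_
  have h1 := integral_mono (μ := weightLaw n S ρ)
    (integrable_hiddenState (fun u v => |layerOp n ρ (fun u v => realOf h u * realOf h v) u v -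
      signCorr n (hammingDist u v)|) x y) (integrable_const (4 * ε))
    fun θ => abs_layerOp_sub_signCorr_le hn hε _ _
  simpa using h1

/-! ### Covariances at fixed and at random inputs. -/

lemma covariance_eq_of_mean_zero {Ω : Type*} [MeasurableSpace Ω] {μ : Measure Ω} {X Y : Ω → ℝ}
    (hX : ∫ ω, X ω ∂μ = 0) (hY : ∫ ω, Y ω ∂μ = 0) : cov[X, Y; μ] = ∫ ω, X ω * Y ω ∂μ := by
  simp [covariance, hX, hY]

lemma measurable_netReal_uncurry (h : Cube n → ℤˣ) :
    Measurable fun p : (Fin T → Fin n → Fin n → ℝ) × Cube n => netReal h p.1 p.2 :=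
  (measurable_of_countable (realOf h)).comp (measurable_hiddenState_uncurry T)

lemma abs_netReal (h : Cube n → ℤˣ) (θ : Fin T → Fin n → Fin n → ℝ) (x : Cube n) :
    |netReal h θ x| = 1 := abs_realOf _ _

/-- The covariance at a random pair of inputs is the average of the correlations. -/
lemma covariance_random_inputs (hρ : ρ < 1) {h : Cube n → ℤˣ} (hh : Function.Odd h) (hT : 0 < T)
    (Q : Measure (Cube n × Cube n)) [IsProbabilityMeasure Q] :
    cov[fun z => netReal h z.2 z.1.1, fun z => netReal h z.2 z.1.2; Q.prod (weightLaw n T ρ)]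
      = ∫ p, pairCorr ρ T h p.1 p.2 ∂Q := by
  have hm1 : Measurable fun z : (Cube n × Cube n) × (Fin T → Fin n → Fin n → ℝ) =>
      netReal h z.2 z.1.1 :=
    (measurable_netReal_uncurry h).comp
      (measurable_snd.prodMk (measurable_fst.comp measurable_fst))
  have hm2 : Measurable fun z : (Cube n × Cube n) × (Fin T → Fin n → Fin n → ℝ) =>
      netReal h z.2 z.1.2 :=
    (measurable_netReal_uncurry h).comp
      (measurable_snd.prodMk (measurable_snd.comp measurable_fst))
  have hi1 : Integrable (fun z => netReal h z.2 z.1.1) (Q.prod (weightLaw n T ρ)) :=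
    Integrable.of_bound hm1.aestronglyMeasurable 1 (ae_of_all _ fun z => (abs_netReal ..).le)
  have hi2 : Integrable (fun z => netReal h z.2 z.1.2) (Q.prod (weightLaw n T ρ)) :=
    Integrable.of_bound hm2.aestronglyMeasurable 1 (ae_of_all _ fun z => (abs_netReal ..).le)
  have hi3 : Integrable (fun z => netReal h z.2 z.1.1 * netReal h z.2 z.1.2)
      (Q.prod (weightLaw n T ρ)) :=
    Integrable.of_bound (hm1.mul hm2).aestronglyMeasurable 1 (ae_of_all _ fun z => by
      rw [Real.norm_eq_abs, abs_mul, abs_netReal, abs_netReal, one_mul])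
  rw [covariance_eq_of_mean_zero, integral_prod _ hi3]
  · rfl
  · rw [integral_prod _ hi1]
    simp [integral_netReal hρ hh hT]
  · rw [integral_prod _ hi2]
    simp [integral_netReal hρ hh hT]

lemma abs_integral_pairCorr_le {h : Cube n → ℤˣ} {ε : ℝ} (hε : 0 ≤ ε)
    (hpair : ∀ x y : Cube n, y ≠ x → y ≠ -x → |pairCorr ρ T h x y| ≤ ε)
    (Q : Measure (Cube n × Cube n)) [IsProbabilityMeasure Q] :
    |∫ p, pairCorr ρ T h p.1 p.2 ∂Q| ≤ Q.real {p | p.2 = p.1 ∨ p.2 = -p.1} + ε := by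
  have hS : MeasurableSet {p : Cube n × Cube n | p.2 = p.1 ∨ p.2 = -p.1} :=
    Set.Finite.measurableSet (Set.toFinite _)
  calc _ ≤ ∫ p, |pairCorr ρ T h p.1 p.2| ∂Q := abs_integral_le_integral_abs
    _ ≤ ∫ p, (Set.indicator {p : Cube n × Cube n | p.2 = p.1 ∨ p.2 = -p.1} (fun _ => (1 : ℝ)) p
        + ε) ∂Q := by
      refine integral_mono .of_finite .of_finite fun p => ?_
      by_cases hp : p.2 = p.1 ∨ p.2 = -p.1
      · have h1 := abs_pairCorr_le_one (ρ := ρ) (T := T) h p.1 p.2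
        simp only [Set.indicator, Set.mem_ofPred_eq, if_pos hp]
        linarith
      · have h1 := hpair p.1 p.2 (fun h => hp (Or.inl h)) (fun h => hp (Or.inr h))
        simp only [Set.indicator, Set.mem_ofPred_eq, if_neg hp]
        linarith
    _ = _ := by
      rw [integral_add .of_finite .of_finite, integral_indicator_const _ hS]
      simp

/-! ### Second moments over Hamming spheres. -/

/-- The Hamming sphere of radius `k` about `x`. -/
def sphere (x : Cube n) (k : ℕ) : Finset (Cube n) := Finset.univ.filter fun y => hammingDist x y = k

lemma card_sphere (x : Cube n) (k : ℕ) : (sphere x k).card = n.choose k := by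
  have h1 : n.choose k = (Finset.powersetCard k (Finset.univ : Finset (Fin n))).card := by simp
  rw [h1]
  refine Finset.card_bij' (fun y _ => Finset.univ.filter fun i => x i ≠ y i)
    (fun s _ i => if i ∈ s then -x i else x i) ?_ ?_ ?_ ?_
  · intro y hy
    simp only [sphere, Finset.mem_filter, Finset.mem_univ, true_and] at hy
    simp only [Finset.mem_powersetCard, Finset.subset_univ, true_and]
    exact hy
  · intro s hs
    simp only [Finset.mem_powersetCard, Finset.subset_univ, true_and] at hs
    simp only [sphere, Finset.mem_filter, Finset.mem_univ, true_and, hammingDist]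
    rw [← hs]
    congr 1
    ext i
    by_cases hi : i ∈ s <;> simp [hi]
  · intro y _
    ext1 i
    rcases Int.units_eq_one_or (x i) with h | h <;> rcases Int.units_eq_one_or (y i) with h' | h' <;>
      simp [h, h']
  · intro s _
    ext i
    by_cases hi : i ∈ s <;> simp [hi]

/-- It makes the spheres large uniformly in `k`, so that equal and opposite pairs are negligible in
the second moment. -/
lemma le_choose_of_mem {n k : ℕ} (h1 : 1 ≤ k) (h2 : k + 1 ≤ n) : n ≤ n.choose k := by
  induction n generalizing k with
  | zero => omega
  | succ n ih =>
    obtain ⟨k, rfl⟩ : ∃ j, k = j + 1 := ⟨k - 1, by omega⟩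
    rw [Nat.choose_succ_succ]
    rcases Nat.eq_zero_or_pos k with rfl | hk
    · simp
    rcases Nat.lt_or_ge (k + 1) n with h | h
    · have h3 := ih (k := k + 1) (by omega) (by omega)
      have h4 := Nat.choose_pos (n := n) (k := k) (by omega)
      simp only [Nat.succ_eq_add_one]
      omega
    · have h3 : n = k + 1 := by omega
      subst h3
      simp

/-- Each point of the sphere contributes `1` if its output agrees with that at `x` and `-1`
otherwise. As the outputs have modulus one, a fraction far from `1/2` means a large sum. -/
lemma flipCount_eq (h : Cube n → ℤˣ) (θ : Fin T → Fin n → Fin n → ℝ) (x : Cube n) (k : ℕ) :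
    netReal h θ x * ∑ y ∈ sphere x k, netReal h θ y
      = n.choose k - 2 * (flipCount h θ x k : ℝ) := by
  have h1 : (flipCount h θ x k : ℝ) = ∑ y ∈ sphere x k, if net h θ y ≠ net h θ x then (1 : ℝ) else 0 := by
    rw [flipCount, sphere, Finset.sum_boole, Finset.filter_filter]
  rw [h1, ← card_sphere x k, Finset.mul_sum, Finset.mul_sum, Finset.cast_card,
    ← Finset.sum_sub_distrib]
  refine Finset.sum_congr rfl fun y _ => ?_
  simp only [netReal]
  rcases Int.units_eq_one_or (net h θ x) with hx | hx <;>
    rcases Int.units_eq_one_or (net h θ y) with hy | hy <;> norm_num [hx, hy]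

lemma sq_le_of_not_mem {h : Cube n → ℤˣ} {θ : Fin T → Fin n → Fin n → ℝ} {x : Cube n} {k : ℕ}
    {γ : ℝ} (hγ : 0 < γ) (hC : 0 < n.choose k)
    (hM : (flipCount h θ x k : ℝ) / (n.choose k : ℝ) ∉ Set.Ioo ((1 - γ) / 2) ((1 + γ) / 2)) :
    (γ * n.choose k) ^ 2 ≤ (∑ y ∈ sphere x k, netReal h θ y) ^ 2 := by
  have hC' : (0 : ℝ) < n.choose k := by exact_mod_cast hC
  have h1 := flipCount_eq h θ x k
  have h2 : |(n.choose k : ℝ) - 2 * (flipCount h θ x k : ℝ)|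
      = |∑ y ∈ sphere x k, netReal h θ y| := by
    rw [← h1, abs_mul, abs_netReal, one_mul]
  rw [← sq_abs (∑ y ∈ sphere x k, netReal h θ y), ← h2]
  have h3 : γ * n.choose k ≤ |(n.choose k : ℝ) - 2 * (flipCount h θ x k : ℝ)| := by
    by_contra! hc
    obtain ⟨h4, h5⟩ := abs_lt.1 hc
    apply hM
    constructor
    · rw [lt_div_iff₀ hC']; linarith
    · rw [div_lt_iff₀ hC']; linarith
  gcongr

/-- A point has at most two partners for which the correlation bound fails, itself and its opposite;
these account for the `2`. -/
lemma integral_sum_sq_le {h : Cube n → ℤˣ} {ε : ℝ} (hε : 0 ≤ ε)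
    (hpair : ∀ x y : Cube n, y ≠ x → y ≠ -x → |pairCorr ρ T h x y| ≤ ε) (s : Finset (Cube n)) :
    ∫ θ, (∑ y ∈ s, netReal h θ y) ^ 2 ∂weightLaw n T ρ ≤ s.card * (2 + s.card * ε) := by
  have h1 : ∀ θ : Fin T → Fin n → Fin n → ℝ, (∑ y ∈ s, netReal h θ y) ^ 2
      = ∑ y ∈ s, ∑ z ∈ s, netReal h θ y * netReal h θ z := fun θ => by
    rw [sq, Finset.sum_mul_sum]
  have hi : ∀ y z : Cube n, Integrable (fun θ => netReal h θ y * netReal h θ z)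
      (weightLaw n T ρ) := fun y z =>
    integrable_hiddenState (fun u v => realOf h u * realOf h v) y z
  simp only [h1]
  rw [integral_finsetSum _ fun y _ => integrable_finsetSum _ fun z _ => hi y z]
  rw [← nsmul_eq_mul]
  refine Finset.sum_le_card_nsmul _ _ _ fun y _ => ?_
  rw [integral_finsetSum _ fun z _ => hi y z]
  calc ∑ z ∈ s, pairCorr ρ T h y z
      ≤ ∑ z ∈ s, ((if z = y then 1 else 0) + (if z = -y then 1 else 0) + ε) := by
        refine Finset.sum_le_sum fun z _ => ?_
        have h2 := (le_abs_self _).trans (abs_pairCorr_le_one (ρ := ρ) (T := T) h y z)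
        by_cases h3 : z = y
        · rw [if_pos h3]; split_ifs <;> linarith
        by_cases h4 : z = -y
        · rw [if_pos h4, if_neg h3]; linarith
        · rw [if_neg h3, if_neg h4]
          linarith [(le_abs_self _).trans (hpair y z h3 h4)]
    _ ≤ 2 + s.card * ε := by
        rw [Finset.sum_add_distrib, Finset.sum_add_distrib, Finset.sum_ite_eq',
          Finset.sum_ite_eq', Finset.sum_const, nsmul_eq_mul]
        gcongr
        split_ifs <;> norm_num

lemma prob_flipCount_le {h : Cube n → ℤˣ} {ε γ : ℝ} (hε : 0 ≤ ε) (hγ : 0 < γ)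
    (hpair : ∀ x y : Cube n, y ≠ x → y ≠ -x → |pairCorr ρ T h x y| ≤ ε) (x : Cube n) {k : ℕ}
    (hk1 : 1 ≤ k) (hk2 : k + 1 ≤ n) :
    (weightLaw n T ρ).real {θ | (flipCount h θ x k : ℝ) / (n.choose k : ℝ) ∉
      Set.Ioo ((1 - γ) / 2) ((1 + γ) / 2)} ≤ (2 / n + ε) / γ ^ 2 := by
  have hC := le_choose_of_mem hk1 hk2
  have hn : (0 : ℝ) < n := by exact_mod_cast (by omega : 0 < n)
  have hC0 : (0 : ℝ) < n.choose k := hn.trans_le (by exact_mod_cast hC)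
  have h1 := integral_sum_sq_le hε hpair (sphere x k)
  rw [card_sphere] at h1
  have hm : Measurable fun θ : Fin T → Fin n → Fin n → ℝ => (∑ y ∈ sphere x k, netReal h θ y) ^ 2 := by
    refine Measurable.pow_const (Finset.measurable_sum _ fun y _ => ?_) 2
    exact (measurable_of_countable (realOf h)).comp (measurable_hiddenState T y)
  have hi : Integrable (fun θ : Fin T → Fin n → Fin n → ℝ => (∑ y ∈ sphere x k, netReal h θ y) ^ 2)
      (weightLaw n T ρ) := by
    refine Integrable.of_bound hm.aestronglyMeasurable ((n.choose k : ℝ) ^ 2)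
      (ae_of_all _ fun θ => ?_)
    rw [Real.norm_eq_abs, abs_pow]
    gcongr
    refine (Finset.abs_sum_le_sum_abs _ _).trans_eq ?_
    simp [abs_netReal, card_sphere]
  have h2 := mul_meas_ge_le_integral_of_nonneg (ae_of_all _ fun θ => sq_nonneg _) hi
    ((γ * n.choose k) ^ 2)
  have h3 : (weightLaw n T ρ).real {θ | (flipCount h θ x k : ℝ) / (n.choose k : ℝ) ∉
      Set.Ioo ((1 - γ) / 2) ((1 + γ) / 2)} ≤ (weightLaw n T ρ).real
      {θ | (γ * n.choose k) ^ 2 ≤ (∑ y ∈ sphere x k, netReal h θ y) ^ 2} :=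
    measureReal_mono fun θ hθ => sq_le_of_not_mem hγ (by exact_mod_cast hC0) hθ
  refine h3.trans ?_
  have h4 := h2.trans h1
  rw [le_div_iff₀ (by positivity)]
  have h5 : (2 : ℝ) / n.choose k ≤ 2 / n := by gcongr
  have h6 : (weightLaw n T ρ).real
      {θ | (γ * n.choose k) ^ 2 ≤ (∑ y ∈ sphere x k, netReal h θ y) ^ 2} * γ ^ 2
      ≤ 2 / n.choose k + ε := by
    have h7 : (2 : ℝ) / n.choose k + ε
        = (n.choose k * (2 + n.choose k * ε)) / (n.choose k : ℝ) ^ 2 := by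
      field_simp
    rw [h7, le_div_iff₀ (by positivity)]
    linarith
  linarith

/-! ### The uniform correlation bound and the theorem. -/

/-- The outputs at two inputs that are neither equal nor opposite are asymptotically
uncorrelated, uniformly in the inputs. -/
theorem eventually_abs_pairCorr_le {S : ℕ → ℕ}
    (hS : ∀ (n : ℕ) (ρ : ℝ), 0 < n → 0 ≤ ρ → ρ < 1 →
      ∀ T, S n ≤ T → ∀ d ≤ n, (stepOp n ρ)^[T] (interior n) d ≤ 1 / ((n : ℝ) + 1))
    {δ : ℝ} {ρ : ℕ → ℝ} {T : ℕ → ℕ} {h : ∀ n : ℕ, Cube n → ℤˣ} (hδ : 0 < δ)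
    (hρ : ∀ᶠ n : ℕ in atTop,
      δ < ρ n ∧ ρ n < 1 - 4 * Real.log (Real.log n) ^ 3 / Real.log n)
    (hT : ∀ᶠ n : ℕ in atTop, Real.exp (4 * Real.log (Real.log n) ^ 2) ≤ (T n : ℝ))
    (hρ1 : ∀ᶠ n : ℕ in atTop, ρ n < 1) (hodd : ∀ᶠ n : ℕ in atTop, Function.Odd (h n))
    (hcase : HasSharpThreshold h ∨ ∀ᶠ n : ℕ in atTop, S n ≤ T n) {ε : ℝ} (hε : 0 < ε) :
    ∀ᶠ n : ℕ in atTop, ∀ x y : Cube n, y ≠ x → y ≠ -x → |pairCorr (ρ n) (T n) (h n) x y| ≤ ε := by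
  have hsurv := (tendsto_surv hδ hρ hT).eventually (gt_mem_nhds (half_pos hε))
  rcases hcase with hsharp | hST
  · filter_upwards [hsurv, hsharp.layer_ne_le hδ (show 0 < ε / 8 by positivity), hρ, hρ1, hT]
      with n h1 h2 h3 h4 h5 x y hxy hxy'
    have hT0 : 0 < T n := by
      have := (Real.exp_pos _).trans_le h5
      exact_mod_cast this
    have := abs_pairCorr_le_of_threshold h4 hT0 (h2 (ρ n) h3.1 h4) hxy hxy'
    linarith
  · have hlim : ∀ᶠ n : ℕ in atTop, 1 / ((n : ℝ) + 1) < ε / 2 :=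
      tendsto_one_div_add_atTop_nhds_zero_nat.eventually (gt_mem_nhds (half_pos hε))
    filter_upwards [hsurv, hST, hρ, hρ1, hodd, hlim, eventually_gt_atTop 0]
      with n h1 h2 h3 h4 h5 h6 h7 x y hxy hxy'
    have := abs_pairCorr_le_of_absorb h4 h5 (hS n (ρ n) h7 (hδ.trans h3.1).le h4 (T n) h2) hxy hxy'
    linarith

end BoolNet

end

theorem mainTheorem5 :
    ∃ S : ℕ → ℕ,
      ∀ (δ : ℝ) (ρ : ℕ → ℝ) (T : ℕ → ℕ) (h : ∀ n : ℕ, BoolNet.Cube n → ℤˣ),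
        0 < δ →
        (∀ᶠ n : ℕ in atTop,
          δ < ρ n ∧ ρ n < 1 - 4 * Real.log (Real.log n) ^ 3 / Real.log n) →
        (∀ᶠ n : ℕ in atTop, Real.exp (4 * Real.log (Real.log n) ^ 2) ≤ (T n : ℝ)) →
        (∀ᶠ n : ℕ in atTop, Function.Odd (h n)) →
        (BoolNet.HasSharpThreshold h ∨ ∀ᶠ n : ℕ in atTop, S n ≤ T n) →
        -- (i) fixed pairs of inputs
        (∀ ω η : ∀ n : ℕ, BoolNet.Cube n,
          (∀ᶠ n : ℕ in atTop, η n ≠ ω n ∧ η n ≠ -ω n) →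
          Tendsto
            (fun n => cov[fun θ => BoolNet.netReal (h n) θ (ω n),
              fun θ => BoolNet.netReal (h n) θ (η n); BoolNet.weightLaw n (T n) (ρ n)])
            atTop (𝓝 0)) ∧
        -- (ii) random pairs of inputs, independent of the weights
        (∀ Q : ∀ n : ℕ, Measure (BoolNet.Cube n × BoolNet.Cube n),
          (∀ n, IsProbabilityMeasure (Q n)) →
          Tendsto (fun n => (Q n).real {p | p.2 = p.1 ∨ p.2 = -p.1}) atTop (𝓝 0) →
          Tendsto
            (fun n => cov[fun z => BoolNet.netReal (h n) z.2 z.1.1,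
              fun z => BoolNet.netReal (h n) z.2 z.1.2;
              (Q n).prod (BoolNet.weightLaw n (T n) (ρ n))])
            atTop (𝓝 0)) ∧
        -- (iii) the fraction of neighbours at distance `k` with the other output
        (∀ (k : ℕ → ℕ) (ω : ∀ n : ℕ, BoolNet.Cube n) (γ : ℝ),
          (∀ᶠ n : ℕ in atTop, 1 ≤ k n ∧ k n ≤ n - 1) → 0 < γ →
          Tendsto
            (fun n => (BoolNet.weightLaw n (T n) (ρ n)).real
              {θ | (BoolNet.flipCount (h n) θ (ω n) (k n) : ℝ) / (n.choose (k n) : ℝ) ∉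
                Set.Ioo ((1 - γ) / 2) ((1 + γ) / 2)})
            atTop (𝓝 0)) := by
  obtain ⟨S, hS⟩ := BoolNet.exists_absorb_time
  refine ⟨S, fun δ ρ T h hδ hρ hT hodd hcase => ?_⟩
  have hlog : Tendsto (fun n : ℕ => Real.log n) atTop atTop :=
    Real.tendsto_log_atTop.comp tendsto_natCast_atTop_atTop
  have hρ1 : ∀ᶠ n : ℕ in atTop, ρ n < 1 := by
    filter_upwards [hρ, hlog.eventually_ge_atTop 1] with n h1 h2
    have h3 : 0 ≤ Real.log (Real.log n) := Real.log_nonneg h2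
    have h4 : 0 ≤ 4 * Real.log (Real.log n) ^ 3 / Real.log n := by positivity
    linarith [h1.2]
  have hT0 : ∀ᶠ n : ℕ in atTop, 0 < T n := by
    filter_upwards [hT] with n h1
    exact_mod_cast (Real.exp_pos _).trans_le h1
  have key : ∀ ε > 0, ∀ᶠ n : ℕ in atTop, ∀ x y : BoolNet.Cube n, y ≠ x → y ≠ -x →
      |BoolNet.pairCorr (ρ n) (T n) (h n) x y| ≤ ε := fun ε hε =>
    BoolNet.eventually_abs_pairCorr_le hS hδ hρ hT hρ1 hodd hcase hε
  refine ⟨fun ω η hne => ?_, fun Q hQ hQlim => ?_, fun k ω γ hk hγ => ?_⟩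
  · rw [Metric.tendsto_nhds]
    intro ε hε
    filter_upwards [key (ε / 2) (half_pos hε), hne, hρ1, hT0, hodd] with n h1 h2 h3 h4 h5
    rw [Real.dist_0_eq_abs, BoolNet.covariance_eq_of_mean_zero (BoolNet.integral_netReal h3 h5 h4 _)
      (BoolNet.integral_netReal h3 h5 h4 _)]
    exact (h1 _ _ h2.1 h2.2).trans_lt (half_lt_self hε)
  · rw [Metric.tendsto_nhds]
    intro ε hε
    filter_upwards [key (ε / 2) (half_pos hε), hQlim.eventually (gt_mem_nhds (half_pos hε)), hρ1,
      hT0, hodd] with n h1 h2 h3 h4 h5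
    have := hQ n
    rw [Real.dist_0_eq_abs, BoolNet.covariance_random_inputs h3 h5 h4]
    have := BoolNet.abs_integral_pairCorr_le (half_pos hε).le h1 (Q n)
    linarith
  · rw [Metric.tendsto_nhds]
    intro ε hε
    -- Chebyshev's inequality divides by `γ ^ 2`, so the diagonal term and the correlation bound
    -- each receive half of `ε * γ ^ 2`.
    have hn : ∀ᶠ n : ℕ in atTop, (2 : ℝ) / n < ε * γ ^ 2 / 2 :=
      (tendsto_const_div_atTop_nhds_zero_nat 2).eventually (gt_mem_nhds (by positivity))
    filter_upwards [key (ε * γ ^ 2 / 2) (by positivity), hk, hn, eventually_gt_atTop 0]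
      with n h1 h2 h3 h4
    rw [Real.dist_0_eq_abs, abs_of_nonneg measureReal_nonneg]
    refine (BoolNet.prob_flipCount_le (by positivity) hγ h1 (ω n) h2.1 (by omega)).trans_lt ?_
    rw [div_lt_iff₀ (by positivity)]
    linarith
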